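/- Theorem 2 (sparse state preparation), together with the lower bound on the depth. A circuit on $n+a$ qubits ($n$ target qubits, $a$ ancillary qubits) is a finite sequence of layers, each consisting of arbitrary single- and two-qubit unitary gates that act on pairwise disjoint sets of qubits; its depth is the number of layers, there are no measurements, and all qubits start in $|0\rangle$. It prepares an $n$-qubit state $|\psi\rangle$ if tracing out the ancillary qubits of its output leaves $|\psi\rangle\langle\psi|$. An $n$-qubit state is $d$-sparse if at most $d$ of its $2^n$ amplitudes in the computational basis are nonzero. (Upper bound) There is an absolute constant $K>0$ such that for all integers $n\ge 1$ and $d\ge 2$, every $n$-qubit $d$-sparse state $|\psi\rangle$ is prepared exactly by a circuit of depth at most $K\log(nd)$ that uses at most $K\,nd\log d$ ancillary qubits and returns all of them to $|0\rangle$ (its output is $|\psi\rangle\otimes|0\rangle^{\otimes a}$). (Lower bound) There is an absolute constant $c>0$ such that for all integers $n$ and $d$ with $2\le d\le 2^n$ there is an $n$-qubit $d$-sparse state such that every circuit that prepares it, with any number of ancillary qubits, has depth at least $c\log(nd)$. Hence the minimum depth that suffices for preparing arbitrary $n$-qubit $d$-sparse states ($2\le d\le 2^n$) is $\Theta(\log(nd))$,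 and it is attained up to a constant factor with $O(nd\log d)$ ancillary qubits. -/

import Mathlib

namespace SparsePrep

/-- A (not necessarily normalized) vector of a register of qubits labelled by `ι`, given by its
amplitudes in the computational basis `ι → Fin 2`. -/
abbrev Ket (ι : Type) : Type := (ι → Fin 2) → ℂ

/-- The vector has norm one. -/
def IsState {ι : Type} [Fintype ι] [DecidableEq ι] (ψ : Ket ι) : Prop :=
  ∑ x, ‖ψ x‖ ^ 2 = 1

/-- At most `d` amplitudes are nonzero. -/
def IsSparse {ι : Type} (d : ℕ) (ψ : Ket ι) : Prop :=
  (Function.support ψ).ncard ≤ d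

/-- The product state `|0…0⟩`. -/
def zeroKet (ι : Type) [Fintype ι] : Ket ι :=
  fun x => if ∀ i, x i = 0 then 1 else 0

/-- The tensor product of two vectors, on the union of the two registers. -/
def tensor {ι κ : Type} (ψ : Ket ι) (φ : Ket κ) : Ket (ι ⊕ κ) :=
  fun x => ψ (fun i => x (Sum.inl i)) * φ (fun j => x (Sum.inr j))

/-- A gate: an arbitrary unitary on one qubit or on two distinct qubits. -/
inductive Gate (ι : Type) : Type where
  | single (i : ι) (U : Matrix.unitaryGroup (Fin 2) ℂ) : Gate ι
  | double (i j : ι) (hij : i ≠ j) (U : Matrix.unitaryGroup (Fin 2 × Fin 2) ℂ) : Gate ι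

/-- The qubits on which a gate acts. -/
def Gate.qubits {ι : Type} : Gate ι → Set ι
  | .single i _ => {i}
  | .double i j _ _ => {i, j}

/-- The action of a gate on the whole register (identity on all other qubits). -/
def Gate.apply {ι : Type} [DecidableEq ι] : Gate ι → Ket ι → Ket ι
  | .single i U, v => fun x =>
      ∑ b : Fin 2, (U : Matrix (Fin 2) (Fin 2) ℂ) (x i) b * v (Function.update x i b)
  | .double i j _ U, v => fun x =>
      ∑ p : Fin 2 × Fin 2, (U : Matrix (Fin 2 × Fin 2) (Fin 2 × Fin 2) ℂ) (x i, x j) p *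
        v (Function.update (Function.update x i p.1) j p.2)

/-- A layer: gates acting on pairwise disjoint sets of qubits (so that they commute and can be
executed in one time step). -/
structure Layer (ι : Type) : Type where
  gates : List (Gate ι)
  disjoint : gates.Pairwise fun g h => Disjoint g.qubits h.qubits

/-- The action of a layer. -/
def Layer.apply {ι : Type} [DecidableEq ι] (L : Layer ι) (v : Ket ι) : Ket ι :=
  L.gates.foldl (fun w g => g.apply w) v

/-- A circuit is a finite sequence of layers; the head of the list is executed first. There are no
measurements. -/
abbrev Circuit (ι : Type) : Type := List (Layer ι)

/-- The depth of a circuit is its number of layers. -/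
def Circuit.depth {ι : Type} (C : Circuit ι) : ℕ := List.length C

/-- The output of a circuit when all qubits start in `|0⟩`. -/
def Circuit.output {ι : Type} [Fintype ι] [DecidableEq ι] (C : Circuit ι) : Ket ι :=
  List.foldl (fun w L => L.apply w) (zeroKet ι) C

/-- The circuit, with `a` ancillary qubits and all qubits starting in `|0⟩`, prepares `ψ` on the
first `n` qubits: tracing out the ancillary qubits of its output leaves `|ψ⟩⟨ψ|`. -/
def Circuit.Prepares {n a : ℕ} (C : Circuit (Fin n ⊕ Fin a)) (ψ : Ket (Fin n)) : Prop :=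
  ∀ x y : Fin n → Fin 2,
    ∑ z : Fin a → Fin 2,
      C.output (Sum.elim x z) * (starRingEnd ℂ) (C.output (Sum.elim y z)) =
    ψ x * (starRingEnd ℂ) (ψ y)

/-- The circuit prepares `ψ` and returns all ancillary qubits to `|0⟩`. -/
def Circuit.PreparesClean {n a : ℕ} (C : Circuit (Fin n ⊕ Fin a)) (ψ : Ket (Fin n)) : Prop :=
  C.output = tensor ψ (zeroKet (Fin a))

/-- Clean preparation is a special case of preparation. -/
theorem Circuit.PreparesClean.prepares {n a : ℕ} {C : Circuit (Fin n ⊕ Fin a)} {ψ : Ket (Fin n)}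
    (h : C.PreparesClean ψ) : C.Prepares ψ := by
  intro x y
  have hx : ∀ (w : Fin n → Fin 2) (z : Fin a → Fin 2),
      tensor ψ (zeroKet (Fin a)) (Sum.elim w z) = ψ w * zeroKet (Fin a) z := fun _ _ => rfl
  have h1 : zeroKet (Fin a) 0 = 1 := if_pos fun _ => rfl
  unfold Circuit.PreparesClean at h
  rw [h, Finset.sum_eq_single (0 : Fin a → Fin 2)]
  · rw [hx, hx, h1, mul_one, mul_one]
  · intro z _ hz
    have h2 : zeroKet (Fin a) z = 0 := if_neg fun hz' => hz (funext hz')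
    rw [hx, hx, h2, mul_zero, zero_mul]
  · intro hz
    exact absurd (Finset.mem_univ _) hz

end SparsePrep

/-!
Both halves rest on the structure of circuits made of disjoint two-qubit gates.

*Lower bound.* In the Heisenberg picture an observable on a set `A` of output qubits becomes an
observable on the backward light cone of `A`, because a gate outside the cone cancels against its
adjoint (`IsLocal.conj_gates`, `Circuit.exists_isLocal_conj`); a layer at most doubles a cone. Two
consequences bound the depth `D`, whatever the number of ancillas.

* All qubits of a GHZ state are correlated with the first one, and observables with disjoint light
  cones are uncorrelated, so `n ≤ 4 ^ D` (`le_of_prepares_ghz`).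
* The density matrix of the prepared state has entries that are polynomials in the `O(n * 2 ^ D)`
  entries of the gates in the light cone of the targets. If the `d` amplitudes are proportional to
  numbers that are algebraically independent over `ℚ`, comparison of transcendence degrees gives
  `d ≤ n * 2 ^ O(D)` (`le_of_prepares_spread`).

The first bound serves when `d ≤ n ^ 4`, the second one otherwise.

*Upper bound.* Let the state be `∑ α_j |x_j⟩`, with `j < 2 ^ k` for some `2 ^ k < 2 * d`. The
superposition `∑ α_j |e_j⟩` of one-hot states is prepared by repeatedly splitting amplitudes
(`exists_circuit_oneHot`). A reversible classical circuit then replaces `e_j` by `x_j`. First each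
bit of the one-hot register is copied `n` times, and target `t` receives the sum over `j` of the
copies with `x_j(t) = 1`, evaluated by a binary tree (`reach_label`). Then the targets are copied
`2 ^ k` times, and a tree of Toffoli gates for each `j` tests whether they contain `x_j`; the outcome
clears the bit `j` of the one-hot register (`reach_clear`). Copying and evaluating trees take
logarithmic depth, all intermediate results are uncomputed, and `O(n * d)` ancillas suffice.
-/

set_option linter.unusedSectionVars false

namespace SparsePrep

open Matrix

/-! ### Matrices of gates and circuits -/

section Basics
variable {ι : Type} [Fintype ι] [DecidableEq ι]

/-- The computational basis vector `|b⟩`. -/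
def ket (b : ι → Fin 2) : Ket ι := fun x => if x = b then 1 else 0

theorem zeroKet_eq_ket : zeroKet ι = ket 0 := by
  funext x
  simp only [zeroKet, ket, funext_iff, Pi.zero_apply]

/-- The matrix of a gate on the whole register. -/
def Gate.mat : Gate ι → Matrix (ι → Fin 2) (ι → Fin 2) ℂ
  | .single i U => fun x y =>
      if ∀ q, q ≠ i → x q = y q then (U : Matrix (Fin 2) (Fin 2) ℂ) (x i) (y i) else 0
  | .double i j _ U => fun x y =>
      if ∀ q, q ≠ i → q ≠ j → x q = y q then
        (U : Matrix (Fin 2 × Fin 2) (Fin 2 × Fin 2) ℂ) (x i, x j) (y i, y j) else 0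

theorem Gate.apply_eq_mulVec (g : Gate ι) (v : Ket ι) : g.apply v = g.mat *ᵥ v := by
  cases g with
  | single i U =>
    funext x
    simp only [Gate.apply, Gate.mat, mulVec, dotProduct, ite_mul, zero_mul]
    rw [← Finset.sum_filter]
    refine Finset.sum_bij' (fun b _ => Function.update x i b) (fun y _ => y i) ?_ ?_ ?_ ?_ ?_
    · intro b _
      simp only [Finset.mem_filter, Finset.mem_univ, true_and]
      intro q hq
      simp [hq]
    · simp
    · simp
    · intro y hy
      simp only [Finset.mem_filter, Finset.mem_univ, true_and] at hy
      funext q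
      by_cases hq : q = i
      · subst hq; simp
      · simp [hq, hy q hq]
    · simp
  | double i j hij U =>
    funext x
    simp only [Gate.apply, Gate.mat, mulVec, dotProduct, ite_mul, zero_mul]
    rw [← Finset.sum_filter]
    refine Finset.sum_bij' (fun p _ => Function.update (Function.update x i p.1) j p.2)
      (fun y _ => (y i, y j)) ?_ ?_ ?_ ?_ ?_
    · intro b _
      simp only [Finset.mem_filter, Finset.mem_univ, true_and]
      intro q hq hq'
      simp [hq, hq']
    · simp
    · intro p _; simp [hij]
    · intro y hy
      simp only [Finset.mem_filter, Finset.mem_univ, true_and] at hy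
      funext q
      by_cases hq : q = j
      · subst hq; simp
      · by_cases hq' : q = i
        · subst hq'; simp [hq]
        · simp [hq, hq', hy q hq' hq]
    · intro p _; simp [hij]

/-- The inverse of a gate. -/
def Gate.inv : Gate ι → Gate ι
  | .single i U => .single i U⁻¹
  | .double i j h U => .double i j h U⁻¹

theorem Gate.inv_qubits (g : Gate ι) : g.inv.qubits = g.qubits := by cases g <;> rfl

theorem Gate.apply_inv (g : Gate ι) (v : Ket ι) : g.inv.apply (g.apply v) = v := by
  cases g with
  | single i U =>
    funext x
    have hU : ((U⁻¹ : unitaryGroup (Fin 2) ℂ) : Matrix (Fin 2) (Fin 2) ℂ) * U = 1 := by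
      rw [← UnitaryGroup.mul_val, inv_mul_cancel]; rfl
    simp only [Gate.apply, Gate.inv, Function.update_self, Function.update_idem, Finset.mul_sum]
    rw [Finset.sum_comm]
    simp only [← mul_assoc, ← Finset.sum_mul]
    have h (c : Fin 2) : ∑ b, (U⁻¹ : unitaryGroup (Fin 2) ℂ) (x i) b * U b c
        = (1 : Matrix (Fin 2) (Fin 2) ℂ) (x i) c := by rw [← hU]; rfl
    simp only [h, Matrix.one_apply, ite_mul, one_mul, zero_mul, Finset.sum_ite_eq,
      Finset.mem_univ, if_true, Function.update_eq_self]
  | double i j hij U =>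
    funext x
    have hU : ((U⁻¹ : unitaryGroup (Fin 2 × Fin 2) ℂ) : Matrix (Fin 2 × Fin 2) (Fin 2 × Fin 2) ℂ)
        * U = 1 := by
      rw [← UnitaryGroup.mul_val, inv_mul_cancel]; rfl
    have hupd (p r : Fin 2 × Fin 2) : Function.update (Function.update (Function.update
        (Function.update x i p.1) j p.2) i r.1) j r.2
        = Function.update (Function.update x i r.1) j r.2 := by
      funext q
      simp only [Function.update_apply]
      split_ifs <;> rfl
    simp only [Gate.apply, Gate.inv, Finset.mul_sum, hupd, Function.update_self,
      Function.update_of_ne hij]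
    rw [Finset.sum_comm]
    simp only [← mul_assoc, ← Finset.sum_mul]
    have h (c : Fin 2 × Fin 2) : ∑ b : Fin 2 × Fin 2,
        (U⁻¹ : unitaryGroup (Fin 2 × Fin 2) ℂ) (x i, x j) b * U b c
        = (1 : Matrix (Fin 2 × Fin 2) (Fin 2 × Fin 2) ℂ) (x i, x j) c := by rw [← hU]; rfl
    simp only [Prod.mk.eta, h, Matrix.one_apply, ite_mul, one_mul, zero_mul, Finset.sum_ite_eq,
      Finset.mem_univ, if_true, Function.update_eq_self]

theorem Gate.inv_mat (g : Gate ι) : g.inv.mat = g.matᴴ := by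
  cases g with
  | single i U =>
    ext x y
    rw [conjTranspose_apply]
    simp only [Gate.inv, Gate.mat, apply_ite star, star_zero]
    refine if_congr ⟨fun h q hq => (h q hq).symm, fun h q hq => (h q hq).symm⟩ ?_ rfl
    rfl
  | double i j hij U =>
    ext x y
    rw [conjTranspose_apply]
    simp only [Gate.inv, Gate.mat, apply_ite star, star_zero]
    refine if_congr ⟨fun h q hq hq' => (h q hq hq').symm, fun h q hq hq' => (h q hq hq').symm⟩ ?_ rfl
    rfl

theorem Gate.conjTranspose_mul_mat (g : Gate ι) : g.matᴴ * g.mat = 1 := by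
  apply Matrix.mulVec_injective
  funext v
  rw [← Matrix.mulVec_mulVec, ← g.inv_mat, ← Gate.apply_eq_mulVec, ← Gate.apply_eq_mulVec,
    Gate.apply_inv, Matrix.one_mulVec]

/-- The matrix of a list of gates, the head of which is applied first. -/
def gatesMat (l : List (Gate ι)) : Matrix (ι → Fin 2) (ι → Fin 2) ℂ :=
  l.foldl (fun M g => g.mat * M) 1

theorem foldl_mat_eq (l : List (Gate ι)) (M : Matrix (ι → Fin 2) (ι → Fin 2) ℂ) :
    l.foldl (fun M g => g.mat * M) M = gatesMat l * M := by
  induction l generalizing M with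
  | nil => simp [gatesMat]
  | cons g l ih =>
    have h : gatesMat (g :: l) = gatesMat l * (g.mat * 1) := ih _
    rw [List.foldl_cons, ih, h, mul_one, mul_assoc]

theorem gatesMat_nil : gatesMat ([] : List (Gate ι)) = 1 := rfl

theorem gatesMat_cons (g : Gate ι) (l : List (Gate ι)) :
    gatesMat (g :: l) = gatesMat l * g.mat := by
  rw [gatesMat, List.foldl_cons, foldl_mat_eq, mul_one]

theorem gatesMat_append (l l' : List (Gate ι)) :
    gatesMat (l ++ l') = gatesMat l' * gatesMat l := by
  rw [gatesMat, List.foldl_append, foldl_mat_eq, foldl_mat_eq, mul_one]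

theorem Layer.apply_eq_mulVec (L : Layer ι) (v : Ket ι) : L.apply v = gatesMat L.gates *ᵥ v := by
  unfold Layer.apply
  generalize L.gates = l
  induction l generalizing v with
  | nil => simp [gatesMat]
  | cons g l ih => rw [List.foldl_cons, ih, gatesMat_cons, Gate.apply_eq_mulVec, mulVec_mulVec]

/-- The gates of a circuit in an order of execution. -/
def Circuit.flat (C : Circuit ι) : List (Gate ι) := C.flatMap Layer.gates

/-- The action of a circuit on an arbitrary vector. -/
def Circuit.run (C : Circuit ι) (v : Ket ι) : Ket ι := List.foldl (fun w L => L.apply w) v C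

theorem Circuit.run_eq_mulVec (C : Circuit ι) (v : Ket ι) :
    C.run v = gatesMat C.flat *ᵥ v := by
  induction C generalizing v with
  | nil => simp [Circuit.run, Circuit.flat, gatesMat]
  | cons L C ih =>
    have h : Circuit.run (L :: C) v = Circuit.run C (L.apply v) := rfl
    rw [h, ih, Layer.apply_eq_mulVec, mulVec_mulVec, ← gatesMat_append]
    rfl

theorem gatesMat_unitary (l : List (Gate ι)) : (gatesMat l)ᴴ * gatesMat l = 1 := by
  induction l with
  | nil => simp [gatesMat]
  | cons g l ih =>
    rw [gatesMat_cons, conjTranspose_mul, mul_assoc, ← mul_assoc _ _ g.mat, ih, one_mul,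
      g.conjTranspose_mul_mat]

end Basics

/-! ### Local operators -/

section Local
variable {ι : Type} [Fintype ι] [DecidableEq ι]

/-- The operator `M` acts only on the qubits of `A`, i.e. `M = M_A ⊗ 1`, and its matrix entries lie
in the algebra `F`. The factorization is encoded by two conditions: entries between basis states that
differ off `A` vanish, and `M` is invariant under simultaneous bit flips off `A`. -/
structure IsLocal (F : Subalgebra ℚ ℂ) (A : Set ι)
    (M : Matrix (ι → Fin 2) (ι → Fin 2) ℂ) : Prop where
  mem : ∀ x y, M x y ∈ F
  off : ∀ x y q, q ∉ A → x q ≠ y q → M x y = 0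
  shift : ∀ w : ι → Fin 2, (∀ q ∈ A, w q = 0) → ∀ x y, M (x + w) (y + w) = M x y

variable {F F' : Subalgebra ℚ ℂ} {A B : Set ι} {M N : Matrix (ι → Fin 2) (ι → Fin 2) ℂ}

theorem IsLocal.mono (h : IsLocal F A M) (hF : F ≤ F') (hA : A ⊆ B) : IsLocal F' B M :=
  ⟨fun x y => hF (h.mem x y), fun x y q hq => h.off x y q fun hq' => hq (hA hq'),
    fun w hw => h.shift w fun q hq => hw q (hA hq)⟩

theorem IsLocal.mul (hM : IsLocal F A M) (hN : IsLocal F A N) : IsLocal F A (M * N) := by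
  refine ⟨fun x y => ?_, fun x y q hq hxy => ?_, fun w hw x y => ?_⟩
  · rw [Matrix.mul_apply]
    exact sum_mem fun z _ => mul_mem (hM.mem _ _) (hN.mem _ _)
  · rw [Matrix.mul_apply]
    refine Finset.sum_eq_zero fun z _ => ?_
    by_cases h : x q = z q
    · rw [hN.off z y q hq (h ▸ hxy), mul_zero]
    · rw [hM.off x z q hq h, zero_mul]
  · rw [Matrix.mul_apply, Matrix.mul_apply]
    rw [← Equiv.sum_comp (Equiv.addRight w)]
    exact Finset.sum_congr rfl fun z _ => by
      rw [Equiv.coe_addRight, hM.shift w hw, hN.shift w hw]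

theorem IsLocal.conjTranspose (hM : IsLocal F A M) (hF : ∀ x y, star (M x y) ∈ F) :
    IsLocal F A Mᴴ :=
  ⟨fun x y => hF y x, fun x y q hq hxy => by
      rw [conjTranspose_apply, hM.off y x q hq hxy.symm, star_zero],
    fun w hw x y => by rw [conjTranspose_apply, hM.shift w hw, conjTranspose_apply]⟩

/-- Operators that act on disjoint sets of qubits commute. -/
theorem IsLocal.commute (hM : IsLocal F A M) (hN : IsLocal F' B N) (hAB : Disjoint A B) :
    M * N = N * M := by
  classical
  ext x z
  rw [Matrix.mul_apply, Matrix.mul_apply]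
  by_cases hxz : ∃ q, q ∉ A ∧ q ∉ B ∧ x q ≠ z q
  · obtain ⟨q, hA, hB, hq⟩ := hxz
    rw [Finset.sum_eq_zero, Finset.sum_eq_zero]
    · intro y _
      by_cases h : x q = y q
      · rw [hM.off y z q hA (h ▸ hq), mul_zero]
      · rw [hN.off x y q hB h, zero_mul]
    · intro y _
      by_cases h : x q = y q
      · rw [hN.off y z q hB (h ▸ hq), mul_zero]
      · rw [hM.off x y q hA h, zero_mul]
  · push Not at hxz
    have hBA : ∀ q ∈ B, q ∉ A := fun q hq hq' => Set.disjoint_left.1 hAB hq' hq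
    -- `y` agrees with `z` on `A` and with `x` off `A`; `y'` the other way round
    rw [Finset.sum_eq_single (fun q => if q ∈ A then z q else x q),
      Finset.sum_eq_single (fun q => if q ∈ A then x q else z q)]
    · rw [mul_comm]
      congr 1
      · rw [← hN.shift (fun q => if q ∈ A then x q - z q else 0)]
        · congr 1
          · funext q; by_cases h : q ∈ A <;> simp [h]
          · funext q; by_cases h : q ∈ A <;> simp [h]
        · intro q hq; simp [hBA q hq]
      · rw [← hM.shift (fun q => if q ∈ A then 0 else z q - x q)]
        · congr 1
          · funext q; by_cases h : q ∈ A <;> simp [h]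
          · funext q; by_cases h : q ∈ A <;> simp [h]
        · intro q hq; simp [hq]
    · intro y _ hy
      obtain ⟨q, hq⟩ := Function.ne_iff.1 hy
      by_cases h : q ∈ A
      · rw [hN.off x y q (fun h' => hBA q h' h) (by simpa [h] using hq.symm), zero_mul]
      · rw [hM.off y z q h (by simpa [h] using hq), mul_zero]
    · simp
    · intro y _ hy
      obtain ⟨q, hq⟩ := Function.ne_iff.1 hy
      by_cases h : q ∈ A
      · rw [hN.off y z q (fun h' => hBA q h' h) (by simpa [h] using hq), mul_zero]
      · rw [hM.off x y q h (by simpa [h] using hq.symm), zero_mul]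
    · simp

/-- The entries of the unitary of a gate, and their complex conjugates. -/
noncomputable def Gate.entries : Gate ι → Finset ℂ
  | .single _ U => Finset.univ.image fun p : Fin 2 × Fin 2 × Bool =>
      bif p.2.2 then (U : Matrix (Fin 2) (Fin 2) ℂ) p.1 p.2.1 else star (U p.1 p.2.1)
  | .double _ _ _ U => Finset.univ.image fun p : (Fin 2 × Fin 2) × (Fin 2 × Fin 2) × Bool =>
      bif p.2.2 then (U : Matrix (Fin 2 × Fin 2) (Fin 2 × Fin 2) ℂ) p.1 p.2.1
      else star (U p.1 p.2.1)

theorem Gate.card_entries (g : Gate ι) : g.entries.card ≤ 32 := by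
  cases g
  · exact Finset.card_image_le.trans (by simp)
  · exact Finset.card_image_le.trans (by simp)

theorem Gate.isLocal_mat (g : Gate ι) (hF : ∀ z ∈ g.entries, z ∈ F) :
    IsLocal F g.qubits g.mat := by
  cases g with
  | single i U =>
    have hq (q : ι) : q ∈ (Gate.single i U).qubits ↔ q = i := Iff.rfl
    refine ⟨fun x y => ?_, fun x y q h hxy => ?_, fun w hw x y => ?_⟩
    · simp only [Gate.mat]
      split_ifs
      · exact hF _ (Finset.mem_image.2 ⟨(x i, y i, true), Finset.mem_univ _, rfl⟩)
      · exact zero_mem _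
    · simp only [Gate.mat]
      exact if_neg fun h' => hxy (h' q h)
    · have hi : w i = 0 := hw i rfl
      simp only [Gate.mat, Pi.add_apply, add_left_inj, hi, add_zero]
  | double i j hij U =>
    refine ⟨fun x y => ?_, fun x y q h hxy => ?_, fun w hw x y => ?_⟩
    · simp only [Gate.mat]
      split_ifs
      · exact hF _ (Finset.mem_image.2 ⟨((x i, x j), (y i, y j), true), Finset.mem_univ _, rfl⟩)
      · exact zero_mem _
    · simp only [Gate.mat]
      exact if_neg fun h' => hxy (h' q (fun e => h (Or.inl e)) (fun e => h (Or.inr e)))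
    · have hi : w i = 0 := hw i (Or.inl rfl)
      have hj : w j = 0 := hw j (Or.inr rfl)
      simp only [Gate.mat, Pi.add_apply, add_left_inj, hi, hj, add_zero]

theorem Gate.star_mat_mem (g : Gate ι) (hF : ∀ z ∈ g.entries, z ∈ F) (x y : ι → Fin 2) :
    star (g.mat x y) ∈ F := by
  cases g with
  | single i U =>
    simp only [Gate.mat]
    split_ifs
    · exact hF _ (Finset.mem_image.2 ⟨(x i, y i, false), Finset.mem_univ _, rfl⟩)
    · rw [star_zero]; exact zero_mem _
  | double i j hij U =>
    simp only [Gate.mat]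
    split_ifs
    · exact hF _ (Finset.mem_image.2 ⟨((x i, x j), (y i, y j), false), Finset.mem_univ _, rfl⟩)
    · rw [star_zero]; exact zero_mem _

/-- Disjoint gates commute. -/
theorem Gate.mat_commute {g h : Gate ι} (hgh : Disjoint g.qubits h.qubits) :
    g.mat * h.mat = h.mat * g.mat :=
  (g.isLocal_mat (F := ⊤) fun _ _ => trivial).commute
    (h.isLocal_mat (F := ⊤) fun _ _ => trivial) hgh

end Local

/-! ### Light cones -/

section Cones
variable {ι : Type} [Fintype ι] [DecidableEq ι]

/-- Two qubits are linked by a layer if they are equal or some gate of the layer acts on both. -/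
def Layer.Linked (L : Layer ι) (q i : ι) : Prop :=
  q = i ∨ ∃ g ∈ L.gates, q ∈ g.qubits ∧ i ∈ g.qubits

/-- The input qubit `q` and the output qubit `i` are joined by a path of gates of the circuit. -/
def Circuit.Linked : Circuit ι → ι → ι → Prop
  | [], q, i => q = i
  | L :: C, q, i => ∃ m, L.Linked q m ∧ Circuit.Linked C m i

/-- The backward light cone of a set `A` of output qubits. -/
def Circuit.cone (C : Circuit ι) (A : Set ι) : Set ι := {q | ∃ i ∈ A, C.Linked q i}

theorem Layer.Linked.symm {L : Layer ι} {q i : ι} (h : L.Linked q i) : L.Linked i q := by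
  rcases h with h | ⟨g, hg, hq, hi⟩
  · exact Or.inl h.symm
  · exact Or.inr ⟨g, hg, hi, hq⟩

theorem Gate.nonempty_qubits (g : Gate ι) : g.qubits.Nonempty := by
  cases g with
  | single i U => exact ⟨i, rfl⟩
  | double i j h U => exact ⟨i, Or.inl rfl⟩

theorem Gate.ncard_qubits (g : Gate ι) : g.qubits.ncard ≤ 2 := by
  cases g with
  | single i U => exact (Set.ncard_singleton i).le.trans one_le_two
  | double i j h U =>
    exact (Set.ncard_insert_le i {j}).trans (by rw [Set.ncard_singleton])

/-- Two gates of a layer that share a qubit are equal. -/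
theorem Layer.eq_of_mem {L : Layer ι} {g h : Gate ι} (hg : g ∈ L.gates) (hh : h ∈ L.gates)
    {q : ι} (hqg : q ∈ g.qubits) (hqh : q ∈ h.qubits) : g = h := by
  by_contra hne
  have : Std.Symm fun g h : Gate ι => Disjoint g.qubits h.qubits := ⟨fun _ _ h => h.symm⟩
  exact Set.disjoint_left.1 (L.disjoint.forall hg hh hne) hqg hqh

theorem Layer.ncard_linked (L : Layer ι) (i : ι) : {q | L.Linked q i}.ncard ≤ 2 := by
  by_cases h : ∃ g ∈ L.gates, i ∈ g.qubits
  · obtain ⟨g, hg, hi⟩ := h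
    refine (Set.ncard_le_ncard ?_ (Set.toFinite _)).trans g.ncard_qubits
    rintro q (rfl | ⟨g', hg', hq, hi'⟩)
    · exact hi
    · rwa [Layer.eq_of_mem hg hg' hi hi']
  · refine (Set.ncard_le_ncard (t := {i}) ?_ (Set.toFinite _)).trans (by simp)
    rintro q (rfl | ⟨g', hg', hq, hi'⟩)
    · rfl
    · exact absurd ⟨g', hg', hi'⟩ h

theorem ncard_image_rel_le (R : ι → ι → Prop) {k : ℕ} (h : ∀ m, {q | R q m}.ncard ≤ k)
    (B : Set ι) : {q | ∃ m ∈ B, R q m}.ncard ≤ k * B.ncard := by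
  classical
  have h1 : {q | ∃ m ∈ B, R q m}
      = ((B.toFinset.biUnion fun m => {q | R q m}.toFinset : Finset ι) : Set ι) := by
    ext q; simp
  rw [h1, Set.ncard_coe_finset, Set.ncard_eq_toFinset_card', mul_comm]
  refine Finset.card_biUnion_le_card_mul _ _ _ fun m _ => ?_
  rw [← Set.ncard_eq_toFinset_card']
  exact h m

theorem Circuit.ncard_cone (C : Circuit ι) (A : Set ι) :
    (C.cone A).ncard ≤ 2 ^ C.depth * A.ncard := by
  induction C with
  | nil => simp [Circuit.cone, Circuit.Linked, Circuit.depth]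
  | cons L C ih =>
    have h : Circuit.cone (L :: C) A = {q | ∃ m ∈ Circuit.cone C A, L.Linked q m} := by
      ext q
      constructor
      · rintro ⟨i, hi, m, hm, hmi⟩; exact ⟨m, ⟨i, hi, hmi⟩, hm⟩
      · rintro ⟨m, ⟨i, hi, hmi⟩, hm⟩; exact ⟨i, hi, m, hm, hmi⟩
    rw [h]
    refine (ncard_image_rel_le _ L.ncard_linked _).trans ?_
    have : Circuit.depth (L :: C) = Circuit.depth C + 1 := rfl
    rw [this, pow_succ']
    nlinarith

/-- The forward light cone of an input qubit doubles at most in each layer. -/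
theorem Circuit.ncard_forward (C : Circuit ι) (q : ι) :
    {i | C.Linked q i}.ncard ≤ 2 ^ C.depth := by
  induction C generalizing q with
  | nil => simp [Circuit.Linked, Circuit.depth]
  | cons L C ih =>
    have h : {i | Circuit.Linked (L :: C) q i}
        = {i | ∃ m ∈ {m | L.Linked q m}, Circuit.Linked C m i} := rfl
    rw [h]
    refine (ncard_image_rel_le (fun i m => Circuit.Linked C m i) ih _).trans ?_
    have : Circuit.depth (L :: C) = Circuit.depth C + 1 := rfl
    rw [this, pow_succ]
    refine Nat.mul_le_mul_left _ ?_
    have h2 : {m | L.Linked q m} = {m | L.Linked m q} :=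
      Set.ext fun m => ⟨Layer.Linked.symm, Layer.Linked.symm⟩
    rw [h2]
    exact L.ncard_linked q

variable {F : Subalgebra ℚ ℂ} {A B : Set ι} {M : Matrix (ι → Fin 2) (ι → Fin 2) ℂ}

/-- In the Heisenberg picture a layer preserves the locality on `B` if none of its gates crosses
the boundary of `B`: a gate outside `B` cancels against its adjoint. -/
theorem IsLocal.conj_gates (hM : IsLocal F B M) (l : List (Gate ι))
    (hl : ∀ g ∈ l, (g.qubits ⊆ B ∧ ∀ z ∈ g.entries, z ∈ F) ∨ Disjoint g.qubits B) :
    IsLocal F B ((gatesMat l)ᴴ * M * gatesMat l) := by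
  induction l with
  | nil => simpa [gatesMat_nil] using hM
  | cons g l ih =>
    have h1 := ih fun g' hg' => hl g' (List.mem_cons_of_mem _ hg')
    have h2 : (gatesMat (g :: l))ᴴ * M * gatesMat (g :: l)
        = g.matᴴ * ((gatesMat l)ᴴ * M * gatesMat l) * g.mat := by
      rw [gatesMat_cons, conjTranspose_mul]
      simp only [mul_assoc]
    rw [h2]
    rcases hl g List.mem_cons_self with ⟨hgB, hgF⟩ | hg
    · have hg := g.isLocal_mat hgF
      exact (((hg.conjTranspose (g.star_mat_mem hgF)).mono le_rfl hgB).mul h1).mul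
        (hg.mono le_rfl hgB)
    · rw [mul_assoc, h1.commute (g.isLocal_mat (F := ⊤) fun _ _ => trivial) hg.symm, ← mul_assoc,
        g.conjTranspose_mul_mat, one_mul]
      exact h1

theorem length_le_ncard_of_disjoint (l : List (Gate ι))
    (hl : l.Pairwise fun g h => Disjoint g.qubits h.qubits) (B : Set ι)
    (hB : ∀ g ∈ l, g.qubits ⊆ B) : l.length ≤ B.ncard := by
  induction l generalizing B with
  | nil => simp
  | cons g l ih =>
    rw [List.pairwise_cons] at hl
    have h1 := ih hl.2 (B \ g.qubits) fun h hh =>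
      Set.subset_sdiff.2 ⟨hB h (List.mem_cons_of_mem _ hh), (hl.1 h hh).symm⟩
    obtain ⟨q, hq⟩ := g.nonempty_qubits
    have h2 : (B \ g.qubits).ncard < B.ncard :=
      Set.ncard_lt_ncard ⟨Set.sdiff_subset, fun h => (h (hB g List.mem_cons_self hq)).2 hq⟩
        (Set.toFinite _)
    rw [List.length_cons]
    omega

theorem exists_entries (l : List (Gate ι)) :
    ∃ S : Finset ℂ, S.card ≤ 32 * l.length ∧ ∀ g ∈ l, g.entries ⊆ S := by
  classical
  induction l with
  | nil => exact ⟨∅, by simp, by simp⟩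
  | cons g l ih =>
    obtain ⟨S, hS, hl⟩ := ih
    refine ⟨g.entries ∪ S, ?_, ?_⟩
    · have := Finset.card_union_le g.entries S
      have := g.card_entries
      rw [List.length_cons]
      omega
    · intro h hh
      rcases List.mem_cons.1 hh with rfl | hh
      · exact Finset.subset_union_left
      · exact (hl h hh).trans Finset.subset_union_right

/-- An observable on `A`, transported to the input of a circuit, lives on the backward light cone
of `A`, and the entries of its matrix are polynomials in few numbers: the entries of the gates in
the light cone. -/
theorem Circuit.exists_isLocal_conj (C : Circuit ι) (A : Set ι) :
    ∃ S : Finset ℂ, S.card + 64 * A.ncard ≤ 64 * A.ncard * 2 ^ C.depth ∧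
      ∀ (F : Subalgebra ℚ ℂ) (M : Matrix (ι → Fin 2) (ι → Fin 2) ℂ), (∀ z ∈ S, z ∈ F) →
        IsLocal F A M → IsLocal F (C.cone A) ((gatesMat C.flat)ᴴ * M * gatesMat C.flat) := by
  classical
  induction C with
  | nil =>
    refine ⟨∅, by simp [Circuit.depth], fun F M _ hM => ?_⟩
    simpa [Circuit.flat, gatesMat_nil, Circuit.cone, Circuit.Linked] using hM
  | cons L C ih =>
    obtain ⟨S, hS, hC⟩ := ih
    set B := Circuit.cone (L :: C) A with hB
    obtain ⟨T, hT, hTl⟩ := exists_entries (L.gates.filter fun g => g.qubits ⊆ B)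
    have hlen : (L.gates.filter fun g => g.qubits ⊆ B).length ≤ B.ncard :=
      length_le_ncard_of_disjoint _ (L.disjoint.sublist List.filter_sublist) B
        fun g hg => by simpa using (List.mem_filter.1 hg).2
    have hBc : B.ncard ≤ 2 ^ Circuit.depth C * 2 * A.ncard := Circuit.ncard_cone (L :: C) A
    refine ⟨S ∪ T, ?_, fun F M hF hM => ?_⟩
    · have h1 := Finset.card_union_le S T
      have : Circuit.depth (L :: C) = Circuit.depth C + 1 := rfl
      rw [this, pow_succ]
      nlinarith
    · have h1 := hC F M (fun z hz => hF z (Finset.mem_union_left _ hz)) hM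
      have h2 : Circuit.cone C A ⊆ B := by
        rintro q ⟨i, hi, hq⟩
        exact ⟨i, hi, q, Or.inl rfl, hq⟩
      have h3 : (gatesMat (Circuit.flat (L :: C)))ᴴ * M * gatesMat (Circuit.flat (L :: C))
          = (gatesMat L.gates)ᴴ * ((gatesMat (Circuit.flat C))ᴴ * M * gatesMat (Circuit.flat C))
            * gatesMat L.gates := by
        have : Circuit.flat (L :: C) = L.gates ++ Circuit.flat C := rfl
        rw [this, gatesMat_append, conjTranspose_mul]
        simp only [mul_assoc]
      rw [h3]
      refine (h1.mono le_rfl h2).conj_gates _ fun g hg => ?_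
      by_cases hgB : Disjoint g.qubits B
      · exact Or.inr hgB
      · -- a gate that meets the cone shares a qubit with the later part of the cone
        have hsub : g.qubits ⊆ B := by
          obtain ⟨q, hq, i, hi, m, hqm, hmi⟩ := Set.not_disjoint_iff.1 hgB
          have hm : m ∈ g.qubits := by
            rcases hqm with rfl | ⟨h, hh, hqh, hmh⟩
            · exact hq
            · rwa [Layer.eq_of_mem hg hh hq hqh]
          intro q' hq'
          exact ⟨i, hi, m, Or.inr ⟨g, hg, hq', hm⟩, hmi⟩
        refine Or.inl ⟨hsub, fun z hz => hF z (Finset.mem_union_right _ (hTl g ?_ hz))⟩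
        exact List.mem_filter.2 ⟨hg, by simpa using hsub⟩

theorem gatesMat_mul_conjTranspose (l : List (Gate ι)) : gatesMat l * (gatesMat l)ᴴ = 1 :=
  mul_eq_one_comm.1 (gatesMat_unitary l)

/-- On a product state, observables with disjoint supports are uncorrelated. -/
theorem IsLocal.mul_zero_zero {M N : Matrix (ι → Fin 2) (ι → Fin 2) ℂ} (hM : IsLocal F A M)
    (hN : IsLocal F B N) (hAB : Disjoint A B) : (M * N) 0 0 = M 0 0 * N 0 0 := by
  rw [Matrix.mul_apply]
  refine Finset.sum_eq_single 0 (fun y _ hy => ?_) (by simp)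
  obtain ⟨q, hq⟩ := Function.ne_iff.1 hy
  by_cases h : q ∈ A
  · rw [hN.off y 0 q (Set.disjoint_left.1 hAB h) hq, mul_zero]
  · rw [hM.off 0 y q h hq.symm, zero_mul]

/-- If the output of a circuit correlates observables on `A` and `B`, the backward light cones of
`A` and `B` intersect. -/
theorem Circuit.exists_mem_cone_of_correlated (C : Circuit ι)
    {M N : Matrix (ι → Fin 2) (ι → Fin 2) ℂ} (hM : IsLocal ⊤ A M) (hN : IsLocal ⊤ B N)
    (h : ((gatesMat C.flat)ᴴ * (M * N) * gatesMat C.flat) 0 0 ≠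
      ((gatesMat C.flat)ᴴ * M * gatesMat C.flat) 0 0
        * ((gatesMat C.flat)ᴴ * N * gatesMat C.flat) 0 0) :
    ∃ q, q ∈ C.cone A ∧ q ∈ C.cone B := by
  by_contra hne
  push Not at hne
  apply h
  obtain ⟨S, -, hS⟩ := C.exists_isLocal_conj A
  obtain ⟨T, -, hT⟩ := C.exists_isLocal_conj B
  rw [← (hS ⊤ M (fun _ _ => trivial) hM).mul_zero_zero (hT ⊤ N (fun _ _ => trivial) hN)
    (Set.disjoint_left.2 hne)]
  refine congrFun (congrFun (Eq.symm ?_) 0) 0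
  calc (gatesMat C.flat)ᴴ * M * gatesMat C.flat * ((gatesMat C.flat)ᴴ * N * gatesMat C.flat)
      = (gatesMat C.flat)ᴴ * M * (gatesMat C.flat * (gatesMat C.flat)ᴴ) * N * gatesMat C.flat := by
        simp only [mul_assoc]
    _ = (gatesMat C.flat)ᴴ * (M * N) * gatesMat C.flat := by
        rw [gatesMat_mul_conjTranspose, mul_one, mul_assoc _ M N]

end Cones

/-! ### Expectation values in a prepared state -/

section Expectation
variable {n a : ℕ}

/-- The operator `Q ⊗ 1` on targets and ancillas. -/
def onTarget (a : ℕ) (Q : Matrix (Fin n → Fin 2) (Fin n → Fin 2) ℂ) :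
    Matrix (Fin n ⊕ Fin a → Fin 2) (Fin n ⊕ Fin a → Fin 2) ℂ := fun u v =>
  if u ∘ Sum.inr = v ∘ Sum.inr then Q (u ∘ Sum.inl) (v ∘ Sum.inl) else 0

theorem onTarget_isLocal {F : Subalgebra ℚ ℂ} {Q : Matrix (Fin n → Fin 2) (Fin n → Fin 2) ℂ}
    (hQ : ∀ x y, Q x y ∈ F) : IsLocal F (Set.range Sum.inl) (onTarget a Q) := by
  refine ⟨fun x y => ?_, fun x y q hq hxy => ?_, fun w hw x y => ?_⟩
  · unfold onTarget
    split_ifs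
    · exact hQ _ _
    · exact zero_mem _
  · refine if_neg fun h => hxy ?_
    rcases q with q | q
    · exact absurd ⟨q, rfl⟩ hq
    · exact congrFun h q
  · have h1 (x : Fin n ⊕ Fin a → Fin 2) : (x + w) ∘ Sum.inl = x ∘ Sum.inl := by
      funext i; simp [hw (Sum.inl i) ⟨i, rfl⟩]
    have h2 (x : Fin n ⊕ Fin a → Fin 2) : (x + w) ∘ Sum.inr = x ∘ Sum.inr + w ∘ Sum.inr := rfl
    simp only [onTarget, h1, h2, add_left_inj]

theorem onTarget_mul (Q R : Matrix (Fin n → Fin 2) (Fin n → Fin 2) ℂ) :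
    onTarget a (Q * R) = onTarget a Q * onTarget a R := by
  ext u v
  rw [Matrix.mul_apply, ← (Equiv.sumArrowEquivProdArrow _ _ _).symm.sum_comp,
    Fintype.sum_prod_type_right]
  have h (x : Fin n → Fin 2) (z : Fin a → Fin 2) :
      onTarget a Q u ((Equiv.sumArrowEquivProdArrow _ _ _).symm (x, z))
        * onTarget a R ((Equiv.sumArrowEquivProdArrow _ _ _).symm (x, z)) v
      = if z = u ∘ Sum.inr then
          (if u ∘ Sum.inr = v ∘ Sum.inr then Q (u ∘ Sum.inl) x * R x (v ∘ Sum.inl) else 0)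
          else 0 := by
    have h1 : (Equiv.sumArrowEquivProdArrow _ _ _).symm (x, z) ∘ Sum.inl = x := rfl
    have h2 : (Equiv.sumArrowEquivProdArrow _ _ _).symm (x, z) ∘ Sum.inr = z := rfl
    simp only [onTarget, h1, h2]
    by_cases hz : z = u ∘ Sum.inr
    · subst hz; simp
    · rw [if_neg (Ne.symm hz), if_neg hz, zero_mul]
  simp only [h, Finset.sum_ite_irrel, Finset.sum_const_zero, Finset.sum_ite_eq', Finset.mem_univ,
    if_true]
  rfl

theorem Circuit.output_apply (C : Circuit (Fin n ⊕ Fin a)) (u : Fin n ⊕ Fin a → Fin 2) :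
    C.output u = gatesMat C.flat u 0 := by
  have h : C.output = C.run (ket 0) := by rw [← zeroKet_eq_ket]; rfl
  rw [h, Circuit.run_eq_mulVec]
  simp [mulVec, dotProduct, ket]

/-- The expectation value of an observable on the targets, computed at the input of the circuit, is
its expectation value in the prepared state. -/
theorem Circuit.Prepares.expectation {C : Circuit (Fin n ⊕ Fin a)} {ψ : Ket (Fin n)}
    (hC : C.Prepares ψ) (Q : Matrix (Fin n → Fin 2) (Fin n → Fin 2) ℂ) :
    ((gatesMat C.flat)ᴴ * onTarget a Q * gatesMat C.flat) 0 0
      = ∑ x, ∑ y, Q x y * (ψ y * (starRingEnd ℂ) (ψ x)) := by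
  have hC' := fun x y => (hC y x).symm
  simp only [hC', Circuit.output_apply]
  rw [mul_assoc, Matrix.mul_apply, ← (Equiv.sumArrowEquivProdArrow _ _ _).symm.sum_comp,
    Fintype.sum_prod_type]
  refine Finset.sum_congr rfl fun x _ => ?_
  simp only [Matrix.mul_apply]
  have h1 (z : Fin a → Fin 2) : ∑ v, onTarget a Q ((Equiv.sumArrowEquivProdArrow _ _ _).symm (x, z))
      v * gatesMat C.flat v 0 = ∑ y, Q x y * gatesMat C.flat (Sum.elim y z) 0 := by
    rw [← (Equiv.sumArrowEquivProdArrow _ _ _).symm.sum_comp, Fintype.sum_prod_type]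
    refine Finset.sum_congr rfl fun y _ => ?_
    refine (Finset.sum_eq_single z (fun z' _ hz => ?_) (by simp)).trans ?_
    · have : onTarget a Q ((Equiv.sumArrowEquivProdArrow _ _ _).symm (x, z))
        ((Equiv.sumArrowEquivProdArrow _ _ _).symm (y, z')) = 0 := if_neg fun h => hz h.symm
      rw [this, zero_mul]
    · have : onTarget a Q ((Equiv.sumArrowEquivProdArrow _ _ _).symm (x, z))
        ((Equiv.sumArrowEquivProdArrow _ _ _).symm (y, z)) = Q x y := if_pos rfl
      rw [this]
      rfl
  simp only [h1, Finset.mul_sum]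
  rw [Finset.sum_comm]
  refine Finset.sum_congr rfl fun y _ => Finset.sum_congr rfl fun z _ => ?_
  have h2 : (gatesMat C.flat)ᴴ 0 ((Equiv.sumArrowEquivProdArrow _ _ _).symm (x, z))
    = (starRingEnd ℂ) (gatesMat C.flat (Sum.elim x z) 0) := rfl
  rw [h2]
  ring

end Expectation

/-! ### Depth of the GHZ state -/

section GHZ
variable {n a : ℕ}

/-- The GHZ state `(|0…0⟩ + |1…1⟩) / √2`. -/
noncomputable def ghz (n : ℕ) : Ket (Fin n) :=
  fun x => if x = 0 ∨ x = 1 then ((√2)⁻¹ : ℝ) else 0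

theorem ghz_mul_conj (x : Fin n → Fin 2) :
    ghz n x * (starRingEnd ℂ) (ghz n x) = if x = 0 ∨ x = 1 then 1 / 2 else 0 := by
  unfold ghz
  split_ifs
  · rw [Complex.conj_ofReal, ← Complex.ofReal_mul, ← mul_inv, Real.mul_self_sqrt (by norm_num)]
    norm_num
  · simp

theorem ghz_isSparse : IsSparse 2 (ghz n) := by
  refine (Set.ncard_le_ncard (t := {0, 1}) (fun x hx => ?_) (Set.toFinite _)).trans
    ((Set.ncard_insert_le 0 {1}).trans (by rw [Set.ncard_singleton]))
  by_contra h
  exact hx (if_neg h)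

theorem sum_ghz (hn : 1 ≤ n) (f : (Fin n → Fin 2) → ℂ) :
    ∑ x, f x * (ghz n x * (starRingEnd ℂ) (ghz n x)) = (f 0 + f 1) / 2 := by
  have h01 : (0 : Fin n → Fin 2) ≠ 1 := fun h => by
    simpa using congrFun h ⟨0, hn⟩
  have h : ∀ x : Fin n → Fin 2, f x * (ghz n x * (starRingEnd ℂ) (ghz n x))
      = (if x = 0 then f 0 / 2 else 0) + (if x = 1 then f 1 / 2 else 0) := by
    intro x
    rw [ghz_mul_conj]
    by_cases h0 : x = 0
    · subst h0; simp [h01]; ring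
    · by_cases h1 : x = 1
      · subst h1; simp [h0]; ring
      · simp [h0, h1]
  simp only [h, Finset.sum_add_distrib, Finset.sum_ite_eq', Finset.mem_univ, if_true]
  ring

theorem ghz_isState (hn : 1 ≤ n) : IsState (ghz n) := by
  have h := sum_ghz hn fun _ => 1
  simp only [one_mul, Complex.mul_conj'] at h
  unfold IsState
  have h2 : ((∑ x, ‖ghz n x‖ ^ 2 : ℝ) : ℂ) = 1 := by
    push_cast
    rw [h]; norm_num
  exact_mod_cast h2

/-- The projector onto `|1⟩` of the target qubit `i`. -/
def projOne (i : Fin n) : Matrix (Fin n → Fin 2) (Fin n → Fin 2) ℂ :=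
  diagonal fun x => if x i = 1 then 1 else 0

theorem onTarget_projOne_isLocal (i : Fin n) :
    IsLocal ⊤ {Sum.inl i} (onTarget a (projOne i)) := by
  refine ⟨fun _ _ => trivial, fun x y q hq hxy => ?_, fun w hw x y => ?_⟩
  · unfold onTarget projOne
    split_ifs with h
    · refine diagonal_apply_ne _ fun h' => hxy ?_
      rcases q with q | q
      · exact congrFun h' q
      · exact congrFun h q
    · rfl
  · have hi : w (Sum.inl i) = 0 := hw _ rfl
    have h1 (x : Fin n ⊕ Fin a → Fin 2) :
      (x + w) ∘ Sum.inl = x ∘ Sum.inl + w ∘ Sum.inl := rfl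
    have h2 (x : Fin n ⊕ Fin a → Fin 2) :
      (x + w) ∘ Sum.inr = x ∘ Sum.inr + w ∘ Sum.inr := rfl
    simp only [onTarget, projOne, diagonal_apply, h1, h2, add_left_inj, Pi.add_apply,
      Function.comp_apply, hi, add_zero]

theorem expectation_diagonal_ghz (hn : 1 ≤ n) {C : Circuit (Fin n ⊕ Fin a)}
    (hC : C.Prepares (ghz n)) (f : (Fin n → Fin 2) → ℂ) :
    ((gatesMat C.flat)ᴴ * onTarget a (diagonal f) * gatesMat C.flat) 0 0 = (f 0 + f 1) / 2 := by
  rw [hC.expectation, ← sum_ghz hn]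
  refine Finset.sum_congr rfl fun x _ => ?_
  rw [Finset.sum_eq_single x]
  · rw [diagonal_apply_eq]
  · intro y _ hy
    rw [diagonal_apply_ne' _ hy, zero_mul]
  · simp

/-- All qubits of a GHZ state are correlated with the first one, so their light cones meet its
light cone; a light cone of `2 ^ depth` input qubits reaches at most `4 ^ depth` outputs. -/
theorem le_of_prepares_ghz {C : Circuit (Fin n ⊕ Fin a)} (hC : C.Prepares (ghz n)) :
    n ≤ 2 ^ (2 * C.depth) := by
  rcases Nat.eq_zero_or_pos n with rfl | hn
  · exact Nat.zero_le _
  set i₀ : Fin n := ⟨0, hn⟩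
  have hmeet (i : Fin n) : ∃ q, q ∈ C.cone {Sum.inl i₀} ∧ q ∈ C.cone {Sum.inl i} := by
    refine C.exists_mem_cone_of_correlated (onTarget_projOne_isLocal i₀)
      (onTarget_projOne_isLocal i) ?_
    rw [← onTarget_mul, projOne, projOne, diagonal_mul_diagonal, expectation_diagonal_ghz hn hC,
      expectation_diagonal_ghz hn hC, expectation_diagonal_ghz hn hC]
    norm_num
  have hsub : Set.range (Sum.inl : Fin n → Fin n ⊕ Fin a)
      ⊆ {i | ∃ q ∈ C.cone {Sum.inl i₀}, C.Linked q i} := by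
    rintro _ ⟨i, rfl⟩
    obtain ⟨q, hq, j, hj, hqj⟩ := hmeet i
    rw [Set.mem_singleton_iff] at hj
    exact ⟨q, hq, hj ▸ hqj⟩
  have h1 := Set.ncard_le_ncard hsub (Set.toFinite _)
  have h2 := ncard_image_rel_le (fun i q => C.Linked q i) C.ncard_forward (C.cone {Sum.inl i₀})
  have h3 := C.ncard_cone {Sum.inl i₀}
  rw [Set.ncard_singleton, mul_one] at h3
  have h4 : (Set.range (Sum.inl : Fin n → Fin n ⊕ Fin a)).ncard = n := by
    rw [← Set.image_univ, Set.ncard_image_of_injective _ Sum.inl_injective, Set.ncard_univ,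
      Nat.card_fin]
  rw [h4] at h1
  calc n ≤ _ := h1
    _ ≤ _ := h2
    _ ≤ 2 ^ C.depth * 2 ^ C.depth := Nat.mul_le_mul_left _ h3
    _ = 2 ^ (2 * C.depth) := by rw [← pow_add, two_mul]

end GHZ

/-! ### Depth of a sparse state with algebraically independent amplitudes -/

section Transcendence

theorem exists_algebraicIndependent (d : ℕ) :
    ∃ t : Fin d → ℂ, AlgebraicIndependent ℚ t := by
  obtain ⟨s, hs⟩ := exists_isTranscendenceBasis ℚ ℂ
  have h1 := IsAlgClosed.cardinal_le_max_transcendence_basis _ hs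
  have h2 : Infinite s := by
    by_contra hfin
    rw [not_infinite_iff_finite] at hfin
    have h3 : Cardinal.mk s < Cardinal.aleph0 := Cardinal.lt_aleph0_of_finite s
    have h4 : Cardinal.mk ℂ ≤ Cardinal.aleph0 := by
      simpa [h3.le] using h1
    rw [Cardinal.mk_complex] at h4
    exact absurd h4 (not_le.2 Cardinal.aleph0_lt_continuum)
  exact ⟨_, hs.1.comp _ ((Fin.valEmbedding.trans (Infinite.natEmbedding s)).injective)⟩

/-- At most `k` algebraically independent numbers lie in an algebra with `k` generators. -/
theorem AlgebraicIndependent.le_card_of_mem_adjoin {d : ℕ} {t : Fin d → ℂ}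
    (ht : AlgebraicIndependent ℚ t) (S : Finset ℂ)
    (hS : ∀ j, t j ∈ Algebra.adjoin ℚ (S : Set ℂ)) : d ≤ S.card := by
  set R := Algebra.adjoin ℚ (S : Set ℂ) with hR
  have h1 : AlgebraicIndependent ℚ (fun j => (⟨t j, hS j⟩ : R)) :=
    AlgebraicIndependent.of_comp R.val ht
  have h2 := h1.cardinalMk_le_trdeg
  have h3 : Function.Surjective (MvPolynomial.aeval (R := ℚ)
      (fun z : S => (⟨z, Algebra.subset_adjoin z.2⟩ : R))) := by
    rw [← AlgHom.range_eq_top, ← Algebra.adjoin_range_eq_range_aeval]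
    have h := Algebra.adjoin_adjoin_coe_preimage (R := ℚ) (s := (S : Set ℂ))
    rw [← h]
    congr 1
    ext z
    constructor
    · rintro ⟨w, rfl⟩; exact w.2
    · intro hz; exact ⟨⟨z, hz⟩, rfl⟩
  have h4 := trdeg_le_of_surjective _ h3
  rw [MvPolynomial.trdeg_of_isDomain] at h4
  have h5 := h2.trans h4
  simpa using h5

variable {n d : ℕ}

/-- The state with amplitudes proportional to `t` on the basis states `e`. -/
noncomputable def spread (e : Fin d → Fin n → Fin 2) (t : Fin d → ℂ) : Ket (Fin n) := fun x =>
  ∑ j, if e j = x then t j / (√(∑ i, ‖t i‖ ^ 2) : ℝ) else 0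

variable {e : Fin d → Fin n → Fin 2} {t : Fin d → ℂ}

theorem spread_apply (he : Function.Injective e) (j : Fin d) :
    spread e t (e j) = t j / (√(∑ i, ‖t i‖ ^ 2) : ℝ) := by
  simp only [spread, he.eq_iff, Finset.sum_ite_eq', Finset.mem_univ, if_true]

theorem spread_eq_zero {x : Fin n → Fin 2} (hx : ∀ j, e j ≠ x) : spread e t x = 0 :=
  Finset.sum_eq_zero fun j _ => if_neg (hx j)

theorem spread_isSparse : IsSparse d (spread e t) := by
  have h : Function.support (spread e t) ⊆ Set.range e := fun x hx => by
    by_contra h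
    exact hx (spread_eq_zero fun j hj => h ⟨j, hj⟩)
  refine (Set.ncard_le_ncard h (Set.toFinite _)).trans ?_
  rw [← Set.image_univ]
  exact (Set.ncard_image_le (Set.toFinite _)).trans (by simp [Set.ncard_univ])

theorem spread_isState (he : Function.Injective e) (ht : 0 < ∑ i, ‖t i‖ ^ 2) :
    IsState (spread e t) := by
  unfold IsState
  rw [← Finset.sum_subset (Finset.subset_univ (Finset.univ.image e)),
    Finset.sum_image he.injOn]
  · simp only [spread_apply he, norm_div, div_pow, ← Finset.sum_div]
    rw [Complex.norm_real, Real.norm_eq_abs, sq_abs, Real.sq_sqrt ht.le, div_self ht.ne']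
  · intro x _ hx
    rw [spread_eq_zero, norm_zero, zero_pow two_ne_zero]
    rintro j rfl
    exact hx (Finset.mem_image_of_mem _ (Finset.mem_univ _))

/-- The entries of the density matrix of a prepared state are polynomials, with rational
coefficients, in the entries of the gates in a light cone of at most `n * 2 ^ depth` qubits. Up to
one common factor they include the amplitudes, so there cannot be more algebraically independent
amplitudes than gate entries. -/
theorem le_of_prepares_spread {a : ℕ} {C : Circuit (Fin n ⊕ Fin a)}
    (he : Function.Injective e) (ht : AlgebraicIndependent ℚ t) (hd : 1 ≤ d)
    (hC : C.Prepares (spread e t)) :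
    d + 64 * n ≤ 64 * n * 2 ^ C.depth + 1 := by
  classical
  obtain ⟨S, hS, hloc⟩ := C.exists_isLocal_conj (Set.range Sum.inl)
  have hcard : (Set.range (Sum.inl : Fin n → Fin n ⊕ Fin a)).ncard = n := by
    rw [← Set.image_univ, Set.ncard_image_of_injective _ Sum.inl_injective, Set.ncard_univ,
      Nat.card_fin]
  rw [hcard] at hS
  set j₀ : Fin d := ⟨0, hd⟩
  have ht0 : t j₀ ≠ 0 := ht.ne_zero j₀
  have hN : 0 < ∑ i, ‖t i‖ ^ 2 :=
    Finset.sum_pos' (fun i _ => sq_nonneg _) ⟨j₀, Finset.mem_univ _, by positivity⟩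
  set N : ℝ := √(∑ i, ‖t i‖ ^ 2) with hNdef
  have hN0 : (N : ℂ) ≠ 0 := Complex.ofReal_ne_zero.2 (Real.sqrt_pos.2 hN).ne'
  -- the common factor that turns the column `j₀` of the density matrix into the amplitudes
  set z : ℂ := N * N / (starRingEnd ℂ) (t j₀) with hz
  have key (j : Fin d) : t j ∈ Algebra.adjoin ℚ ((insert z S : Finset ℂ) : Set ℂ) := by
    set F := Algebra.adjoin ℚ ((insert z S : Finset ℂ) : Set ℂ)
    have h1 : ∀ w ∈ insert z S, w ∈ F := fun w hw => Algebra.subset_adjoin hw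
    have h2 : IsLocal F (Set.range Sum.inl) (onTarget a (Matrix.single (e j₀) (e j) (1 : ℂ))) := by
      refine onTarget_isLocal fun x y => ?_
      rw [Matrix.single_apply]
      split_ifs
      · exact one_mem _
      · exact zero_mem _
    have h3 := (hloc F _ (fun w hw => h1 w (Finset.mem_insert_of_mem hw)) h2).mem 0 0
    rw [hC.expectation] at h3
    simp only [Matrix.single_apply, ite_and, ite_mul, one_mul, zero_mul, Finset.sum_ite_irrel,
      Finset.sum_const_zero, Finset.sum_ite_eq, Finset.mem_univ, if_true] at h3
    rw [spread_apply he, spread_apply he, ← hNdef] at h3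
    have h4 := mul_mem h3 (h1 z (Finset.mem_insert_self _ _))
    have h5 : t j / N * (starRingEnd ℂ) (t j₀ / N) * z = t j := by
      have : (starRingEnd ℂ) (t j₀) ≠ 0 := (map_ne_zero _).2 ht0
      rw [hz, map_div₀, Complex.conj_ofReal]
      field_simp
    rwa [h5] at h4
  have h1 := AlgebraicIndependent.le_card_of_mem_adjoin ht _ key
  have h2 := Finset.card_insert_le z S
  omega

end Transcendence

/-! ### The lower bound on the depth -/

theorem exists_depth_lower_bound : ∃ c : ℝ, 0 < c ∧ ∀ n d : ℕ, 2 ≤ d → d ≤ 2 ^ n →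
      ∃ ψ : Ket (Fin n), IsState ψ ∧ IsSparse d ψ ∧
        ∀ (a : ℕ) (C : Circuit (Fin n ⊕ Fin a)),
          C.Prepares ψ → c * Real.log ((n : ℝ) * (d : ℝ)) ≤ (C.depth : ℝ) := by
  have hl2 : 0 < Real.log 2 := Real.log_pos one_lt_two
  refine ⟨1 / (12 * Real.log 2), by positivity, fun n d hd hdn => ?_⟩
  have hn : 1 ≤ n := by
    rcases Nat.eq_zero_or_pos n with rfl | h
    · omega
    · exact h
  have hn' : (0 : ℝ) < n := by exact_mod_cast hn
  have hd' : (0 : ℝ) < d := by exact_mod_cast (by omega : 0 < d)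
  -- it suffices to bound `log (n * d)` by a multiple of the depth
  have hfin (D : ℕ) (h : Real.log n + Real.log d ≤ 12 * D * Real.log 2) :
      1 / (12 * Real.log 2) * Real.log ((n : ℝ) * (d : ℝ)) ≤ (D : ℝ) := by
    rw [Real.log_mul hn'.ne' hd'.ne', one_div, inv_mul_le_iff₀ (by positivity)]
    linarith
  by_cases hcase : d ≤ n ^ 4
  · refine ⟨ghz n, ghz_isState hn, ghz_isSparse.trans hd, fun a C hC => hfin _ ?_⟩
    have h1 : (n : ℝ) ≤ 2 ^ (2 * C.depth) := by exact_mod_cast le_of_prepares_ghz hC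
    have h2 := Real.log_le_log hn' h1
    have h3 : (d : ℝ) ≤ (n : ℝ) ^ 4 := by exact_mod_cast hcase
    have h4 := Real.log_le_log hd' h3
    rw [Real.log_pow] at h2 h4
    push_cast at h2 h4
    have : 0 ≤ (C.depth : ℝ) * Real.log 2 := by positivity
    nlinarith
  · obtain ⟨t, ht⟩ := exists_algebraicIndependent d
    have hcard : Fintype.card (Fin d) ≤ Fintype.card (Fin n → Fin 2) := by simpa using hdn
    obtain ⟨e⟩ := Function.Embedding.nonempty_of_card_le hcard
    have hpos : 0 < ∑ i, ‖t i‖ ^ 2 := by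
      refine Finset.sum_pos' (fun i _ => sq_nonneg _) ⟨⟨0, by omega⟩, Finset.mem_univ _, ?_⟩
      have := ht.ne_zero ⟨0, by omega⟩
      positivity
    refine ⟨spread e t, spread_isState e.injective hpos, spread_isSparse, fun a C hC =>
      hfin _ ?_⟩
    have h1 := le_of_prepares_spread e.injective ht (by omega) hC
    have hD : 1 ≤ C.depth := by
      by_contra h
      have h0 : C.depth = 0 := by omega
      rw [h0] at h1
      omega
    have h2 : d ≤ n * 2 ^ (7 * C.depth) := by
      have h3 : 2 ^ (6 + C.depth) ≤ 2 ^ (7 * C.depth) :=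
        Nat.pow_le_pow_right two_pos (by omega)
      have h4 : 64 * n * 2 ^ C.depth = n * 2 ^ (6 + C.depth) := by rw [pow_add]; ring
      have h5 := Nat.mul_le_mul_left n h3
      omega
    have h3 : (d : ℝ) ≤ n * 2 ^ (7 * C.depth) := by exact_mod_cast h2
    have h4 := Real.log_le_log hd' h3
    rw [Real.log_mul hn'.ne' (by positivity), Real.log_pow] at h4
    have h5 : (n : ℝ) ^ 4 ≤ d := by exact_mod_cast (not_le.1 hcase).le
    have h6 := Real.log_le_log (by positivity) h5
    rw [Real.log_pow] at h6
    push_cast at h4 h6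
    have : 0 ≤ (C.depth : ℝ) * Real.log 2 := by positivity
    nlinarith

/-! ### Circuits on a part of the register, inverse circuits, circuits in parallel -/

section Relabel
variable {ι κ : Type} [Fintype ι] [DecidableEq ι] [Fintype κ] [DecidableEq κ]

/-- The same gate, on the qubits relabelled by `e`. -/
def Gate.map (e : ι → κ) (he : Function.Injective e) : Gate ι → Gate κ
  | .single i U => .single (e i) U
  | .double i j h U => .double (e i) (e j) (he.ne h) U

theorem Gate.map_qubits (e : ι → κ) (he : Function.Injective e) (g : Gate ι) :
    (g.map e he).qubits = e '' g.qubits := by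
  cases g with
  | single i U => exact Set.image_singleton.symm
  | double i j h U => exact (Set.image_pair e i j).symm

/-- The same layer, on the qubits relabelled by `e`. -/
def Layer.map (e : ι → κ) (he : Function.Injective e) (L : Layer ι) : Layer κ where
  gates := L.gates.map (Gate.map e he)
  disjoint := by
    rw [List.pairwise_map]
    refine L.disjoint.imp fun h => ?_
    rw [Gate.map_qubits, Gate.map_qubits]
    exact (Set.disjoint_image_iff he).2 h

/-- The same circuit, on the qubits relabelled by `e`. -/
def Circuit.map (e : ι → κ) (he : Function.Injective e) (C : Circuit ι) : Circuit κ :=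
  List.map (Layer.map e he) C

theorem Circuit.run_eq_foldl (C : Circuit ι) (v : Ket ι) :
    C.run v = C.flat.foldl (fun w g => g.apply w) v := by
  induction C generalizing v with
  | nil => rfl
  | cons L C ih =>
    have h : Circuit.run (L :: C) v = Circuit.run C (L.apply v) := rfl
    have h' : Circuit.flat (L :: C) = L.gates ++ Circuit.flat C := rfl
    rw [h, ih, h', List.foldl_append]
    rfl

theorem Circuit.flat_map (e : ι → κ) (he : Function.Injective e) (C : Circuit ι) :
    (C.map e he).flat = C.flat.map (Gate.map e he) := by
  induction C with
  | nil => rfl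
  | cons L C ih =>
    have h' : Circuit.flat (L :: C) = L.gates ++ Circuit.flat C := rfl
    rw [h', List.map_append, ← ih]
    rfl

theorem update_extend {e : ι → κ} (he : Function.Injective e) (y : ι → Fin 2) (x : κ → Fin 2)
    (i : ι) (b : Fin 2) :
    Function.update (Function.extend e y x) (e i) b
      = Function.extend e (Function.update y i b) x := by
  funext q
  by_cases h : ∃ j, e j = q
  · obtain ⟨j, rfl⟩ := h
    rw [he.extend_apply]
    by_cases hj : j = i
    · subst hj; simp
    · rw [Function.update_of_ne (he.ne hj), Function.update_of_ne hj, he.extend_apply]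
  · rw [Function.extend_apply' _ _ _ h, Function.update_of_ne, Function.extend_apply' _ _ _ h]
    rintro rfl
    exact h ⟨i, rfl⟩

theorem Gate.map_apply_extend {e : ι → κ} (he : Function.Injective e) (g : Gate ι) (v : Ket κ)
    (y : ι → Fin 2) (x : κ → Fin 2) :
    (g.map e he).apply v (Function.extend e y x)
      = g.apply (fun y' => v (Function.extend e y' x)) y := by
  cases g with
  | single i U => simp only [Gate.map, Gate.apply, update_extend he, he.extend_apply]
  | double i j h U => simp only [Gate.map, Gate.apply, update_extend he, he.extend_apply]

/-- A relabelled circuit acts on each slice of a vector along the relabelled qubits. -/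
theorem Circuit.map_run_extend {e : ι → κ} (he : Function.Injective e) (C : Circuit ι) (v : Ket κ)
    (y : ι → Fin 2) (x : κ → Fin 2) :
    (C.map e he).run v (Function.extend e y x)
      = C.run (fun y' => v (Function.extend e y' x)) y := by
  rw [Circuit.run_eq_foldl, Circuit.run_eq_foldl, Circuit.flat_map]
  generalize C.flat = l
  induction l generalizing v with
  | nil => rfl
  | cons g l ih =>
    rw [List.map_cons, List.foldl_cons, ih, List.foldl_cons]
    simp only [Gate.map_apply_extend]

theorem Circuit.run_add (C : Circuit ι) (v w : Ket ι) : C.run (v + w) = C.run v + C.run w := by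
  simp only [Circuit.run_eq_mulVec, mulVec_add]

theorem Circuit.run_smul (C : Circuit ι) (c : ℂ) (v : Ket ι) : C.run (c • v) = c • C.run v := by
  simp only [Circuit.run_eq_mulVec, mulVec_smul]

theorem Circuit.run_zero (C : Circuit ι) : C.run 0 = 0 := by
  simp only [Circuit.run_eq_mulVec, mulVec_zero]

theorem Circuit.run_sum {J : Type} (s : Finset J) (C : Circuit ι) (v : J → Ket ι) :
    C.run (∑ j ∈ s, v j) = ∑ j ∈ s, C.run (v j) := by
  classical
  induction s using Finset.induction_on with
  | empty => simp [Circuit.run_zero]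
  | insert j s hj ih => rw [Finset.sum_insert hj, Finset.sum_insert hj, Circuit.run_add, ih]

theorem Circuit.run_append (C C' : Circuit ι) (v : Ket ι) :
    Circuit.run (C ++ C') v = C'.run (C.run v) := List.foldl_append

theorem extend_comp_self {e : ι → κ} (he : Function.Injective e) (x : κ → Fin 2) :
    Function.extend e (x ∘ e) x = x := by
  funext q
  by_cases h : ∃ i, e i = q
  · obtain ⟨i, rfl⟩ := h
    rw [he.extend_apply]; rfl
  · rw [Function.extend_apply' _ _ _ h]

theorem ket_extend {e : ι → κ} (he : Function.Injective e) (B x : κ → Fin 2) (y : ι → Fin 2) :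
    ket (Function.extend e y B) x
      = if ∀ q, (¬∃ i, e i = q) → x q = B q then ket y (x ∘ e) else 0 := by
  unfold ket
  rw [← ite_and]
  refine if_congr ⟨?_, ?_⟩ rfl rfl
  · rintro rfl
    exact ⟨fun q hq => Function.extend_apply' _ _ _ hq, funext fun i => he.extend_apply _ _ _⟩
  · rintro ⟨h1, rfl⟩
    funext q
    by_cases h : ∃ i, e i = q
    · obtain ⟨i, rfl⟩ := h
      rw [he.extend_apply]; rfl
    · rw [Function.extend_apply' _ _ _ h, h1 q h]

theorem Circuit.map_run_ket {e : ι → κ} (he : Function.Injective e) (C : Circuit ι)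
    (B x : κ → Fin 2) :
    (C.map e he).run (ket B) x
      = if ∀ q, (¬∃ i, e i = q) → x q = B q then C.run (ket (B ∘ e)) (x ∘ e) else 0 := by
  conv_lhs => rw [← extend_comp_self he x, Circuit.map_run_extend he]
  have h (y : ι → Fin 2) : ket B (Function.extend e y x)
      = if ∀ q, (¬∃ i, e i = q) → x q = B q then ket (B ∘ e) y else 0 := by
    conv_lhs => rw [← extend_comp_self he B, ket_extend he]
    have h1 : Function.extend e y x ∘ e = y := funext fun i => he.extend_apply _ _ _
    rw [h1]
    refine if_congr (forall_congr' fun q => imp_congr_right fun hq => ?_) rfl rfl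
    rw [Function.extend_apply' _ _ _ hq]
  simp only [h]
  split_ifs with hc
  · rfl
  · exact congrFun (Circuit.run_zero C) _

theorem Circuit.map_run_ket_eq {e : ι → κ} (he : Function.Injective e) {C : Circuit ι}
    {B : κ → Fin 2} {b : ι → Fin 2} (h : C.run (ket (B ∘ e)) = ket b) :
    (C.map e he).run (ket B) = ket (Function.extend e b B) := by
  funext x
  rw [Circuit.map_run_ket he, ket_extend he, h]

/-- All gates of the circuit act inside `A`. -/
def Circuit.SupportedIn (C : Circuit ι) (A : Set ι) : Prop := ∀ g ∈ C.flat, g.qubits ⊆ A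

theorem Circuit.map_supportedIn (e : ι → κ) (he : Function.Injective e) (C : Circuit ι) :
    (C.map e he).SupportedIn (Set.range e) := by
  intro g hg
  rw [Circuit.flat_map, List.mem_map] at hg
  obtain ⟨g, -, rfl⟩ := hg
  rw [Gate.map_qubits]
  exact Set.image_subset_range _ _

end Relabel

section Parallel
variable {ι : Type} [Fintype ι] [DecidableEq ι]

theorem gatesMat_commute_gate (l : List (Gate ι)) (g : Gate ι)
    (h : ∀ g' ∈ l, Disjoint g'.qubits g.qubits) : gatesMat l * g.mat = g.mat * gatesMat l := by
  induction l with
  | nil => simp [gatesMat_nil]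
  | cons g' l ih =>
    rw [gatesMat_cons, mul_assoc, Gate.mat_commute (h g' List.mem_cons_self), ← mul_assoc,
      ih fun g'' hg'' => h g'' (List.mem_cons_of_mem _ hg''), mul_assoc]

theorem gatesMat_commute (l l' : List (Gate ι))
    (h : ∀ g ∈ l, ∀ g' ∈ l', Disjoint g.qubits g'.qubits) :
    gatesMat l * gatesMat l' = gatesMat l' * gatesMat l := by
  induction l' with
  | nil => simp [gatesMat_nil]
  | cons g' l' ih =>
    rw [gatesMat_cons, ← mul_assoc,
      ih fun g hg g'' hg'' => h g hg g'' (List.mem_cons_of_mem _ hg''), mul_assoc,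
      gatesMat_commute_gate l g' fun g hg => h g hg g' List.mem_cons_self, mul_assoc]

/-- Circuits on disjoint sets of qubits can be executed at the same time. -/
theorem Circuit.exists_parallel {A B : Set ι} (hAB : Disjoint A B) (D : ℕ) (C C' : Circuit ι)
    (hC : C.SupportedIn A) (hC' : C'.SupportedIn B) (hD : C.depth ≤ D) (hD' : C'.depth ≤ D) :
    ∃ P : Circuit ι, P.depth ≤ D ∧ P.SupportedIn (A ∪ B) ∧ ∀ v, P.run v = C'.run (C.run v) := by
  induction C generalizing C' D with
  | nil => exact ⟨C', hD', fun g hg => (hC' g hg).trans Set.subset_union_right, fun v => rfl⟩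
  | cons L C ih =>
    cases C' with
    | nil => exact ⟨L :: C, hD, fun g hg => (hC g hg).trans Set.subset_union_left, fun v => rfl⟩
    | cons L' C' =>
      obtain ⟨D, rfl⟩ : ∃ D', D = D' + 1 :=
        ⟨D - 1, by have : 1 ≤ D := (Nat.succ_pos _).trans_le hD; omega⟩
      have hL : ∀ g ∈ L.gates, g.qubits ⊆ A := fun g hg =>
        hC g (List.mem_append_left _ hg)
      have hL' : ∀ g ∈ L'.gates, g.qubits ⊆ B := fun g hg =>
        hC' g (List.mem_append_left _ hg)
      have hCt : Circuit.SupportedIn C A := fun g hg => hC g (List.mem_append_right _ hg)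
      obtain ⟨P, hP, hPs, hPr⟩ := ih D C' hCt
        (fun g hg => hC' g (List.mem_append_right _ hg)) (Nat.le_of_succ_le_succ hD)
        (Nat.le_of_succ_le_succ hD')
      refine ⟨⟨L.gates ++ L'.gates, List.pairwise_append.2 ⟨L.disjoint, L'.disjoint,
        fun g hg g' hg' => hAB.mono (hL g hg) (hL' g' hg')⟩⟩ :: P, Nat.succ_le_succ hP, ?_, ?_⟩
      · intro g hg
        rcases List.mem_append.1 hg with hg | hg
        · rcases List.mem_append.1 hg with hg | hg
          · exact (hL g hg).trans Set.subset_union_left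
          · exact (hL' g hg).trans Set.subset_union_right
        · exact hPs g hg
      · intro v
        have h1 (M : Layer ι) (E : Circuit ι) (w : Ket ι) :
            Circuit.run (M :: E) w = Circuit.run E (M.apply w) := rfl
        rw [h1, hPr, h1, h1, Layer.apply_eq_mulVec, gatesMat_append, ← mulVec_mulVec,
          Layer.apply_eq_mulVec L', Layer.apply_eq_mulVec L, Circuit.run_eq_mulVec C,
          Circuit.run_eq_mulVec C]
        congr 1
        rw [mulVec_mulVec _ (gatesMat (Circuit.flat C)), mulVec_mulVec _ (gatesMat L'.gates),
          gatesMat_commute _ _ fun g hg g' hg' => hAB.mono (hCt g hg) (hL' g' hg')]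

/-- The inverse of a layer. -/
def Layer.inv (L : Layer ι) : Layer ι where
  gates := (L.gates.map Gate.inv).reverse
  disjoint := by
    rw [List.pairwise_reverse, List.pairwise_map]
    refine L.disjoint.imp fun h => ?_
    rw [Gate.inv_qubits, Gate.inv_qubits]
    exact h.symm

theorem Layer.apply_inv (L : Layer ι) (v : Ket ι) : L.inv.apply (L.apply v) = v := by
  have h (l : List (Gate ι)) : (l.map Gate.inv).reverse.foldl (fun w g => g.apply w)
      (l.foldl (fun w g => g.apply w) v) = v := ?_
  · exact h L.gates
  induction l generalizing v with
  | nil => rfl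
  | cons g l ih =>
    simp only [List.map_cons, List.reverse_cons, List.foldl_append, List.foldl_cons,
      List.foldl_nil] at ih ⊢
    rw [ih, Gate.apply_inv]

/-- The inverse of a circuit. -/
def Circuit.inv (C : Circuit ι) : Circuit ι := List.reverse (List.map Layer.inv C)

theorem Circuit.run_inv (C : Circuit ι) (v : Ket ι) : C.inv.run (C.run v) = v := by
  induction C generalizing v with
  | nil => rfl
  | cons L C ih =>
    have h1 : Circuit.inv (L :: C) = Circuit.inv C ++ [L.inv] := by simp [Circuit.inv]
    have h2 : Circuit.run (L :: C) v = Circuit.run C (L.apply v) := rfl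
    rw [h1, h2, Circuit.run_append, ih]
    exact L.apply_inv v

end Parallel

/-! ### Reversible classical computations -/

section Reach
variable {Ω ι κ : Type} [Fintype ι] [DecidableEq ι] [Fintype κ] [DecidableEq κ]

/-- One circuit of depth at most `D` maps, for all `ω` at once, the basis state `β ω` to the basis
state `β' ω`. The index `ω` stands for the inputs on which the computation has to be correct. -/
def Reach (D : ℕ) (β β' : Ω → ι → Fin 2) : Prop :=
  ∃ C : Circuit ι, C.depth ≤ D ∧ ∀ ω, C.run (ket (β ω)) = ket (β' ω)

variable {D D' : ℕ} {β β' β'' : Ω → ι → Fin 2}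

theorem Reach.refl (β : Ω → ι → Fin 2) : Reach 0 β β := ⟨[], le_rfl, fun _ => rfl⟩

theorem Reach.of_eq {γ γ' : Ω → ι → Fin 2} (h : Reach D β β') (h1 : ∀ ω, γ ω = β ω)
    (h2 : ∀ ω, γ' ω = β' ω) : Reach D γ γ' := by
  rwa [funext h1, funext h2]

theorem Reach.mono (h : Reach D β β') (hD : D ≤ D') : Reach D' β β' :=
  let ⟨C, h1, h2⟩ := h
  ⟨C, h1.trans hD, h2⟩

theorem Reach.trans (h : Reach D β β') (h' : Reach D' β' β'') : Reach (D + D') β β'' := by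
  obtain ⟨C, h1, h2⟩ := h
  obtain ⟨C', h1', h2'⟩ := h'
  refine ⟨C ++ C', ?_, fun ω => by rw [Circuit.run_append, h2, h2']⟩
  exact (List.length_append).le.trans (add_le_add h1 h1')

theorem Reach.symm (h : Reach D β β') : Reach D β' β := by
  obtain ⟨C, h1, h2⟩ := h
  refine ⟨C.inv, ?_, fun ω => by rw [← h2, Circuit.run_inv]⟩
  have : Circuit.depth (Circuit.inv C) = Circuit.depth C := by simp [Circuit.inv, Circuit.depth]
  exact this.le.trans h1

theorem Reach.comp {Ω' : Type} (h : Reach D β β') (f : Ω' → Ω) : Reach D (β ∘ f) (β' ∘ f) :=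
  let ⟨C, h1, h2⟩ := h
  ⟨C, h1, fun ω => h2 (f ω)⟩

/-- Computations on the disjoint parts `e g` of a register, executed at the same time. -/
theorem Reach.parallel {G : Type} [Finite G] (e : G → ι → κ)
    (he : Function.Injective fun p : G × ι => e p.1 p.2) {B B' : Ω → κ → Fin 2}
    (h : ∀ g, Reach D (fun ω => B ω ∘ e g) (fun ω => B' ω ∘ e g))
    (hoff : ∀ ω q, (∀ g i, e g i ≠ q) → B' ω q = B ω q) : Reach D B B' := by
  classical
  cases nonempty_fintype G
  have heg (g : G) : Function.Injective (e g) := fun i j hij =>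
    congrArg Prod.snd (@he (g, i) (g, j) hij)
  choose C hCD hC using h
  have key (s : Finset G) : ∃ P : Circuit κ, P.depth ≤ D ∧
      P.SupportedIn (⋃ g ∈ s, Set.range (e g)) ∧ ∀ ω, P.run (ket (B ω))
        = ket (fun q => if ∃ g ∈ s, ∃ i, e g i = q then B' ω q else B ω q) := by
    induction s using Finset.induction_on with
    | empty =>
      refine ⟨[], Nat.zero_le _, fun g hg => ?_, fun ω => ?_⟩
      · simp [Circuit.flat] at hg
      · simp [Circuit.run]
    | insert g s hg ih =>
      obtain ⟨P, hPD, hPs, hP⟩ := ih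
      have hdisj : Disjoint (⋃ g ∈ s, Set.range (e g)) (Set.range (e g)) := by
        rw [Set.disjoint_left]
        rintro q hq ⟨i, rfl⟩
        simp only [Set.mem_iUnion, Set.mem_range] at hq
        obtain ⟨g', hg', j, hj⟩ := hq
        obtain rfl : g' = g := congrArg Prod.fst (@he (g', j) (g, i) hj)
        exact hg hg'
      obtain ⟨P', hPD', hPs', hP'⟩ := Circuit.exists_parallel hdisj D P ((C g).map (e g) (heg g))
        hPs (Circuit.map_supportedIn _ _ _) hPD
        ((List.length_map (Layer.map (e g) (heg g))).le.trans (hCD g))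
      refine ⟨P', hPD', ?_, fun ω => ?_⟩
      · rw [Finset.set_biUnion_insert, Set.union_comm]
        exact hPs'
      · have hnot (i : ι) : ¬∃ g' ∈ s, ∃ j, e g' j = e g i := by
          rintro ⟨g', hg', j, hj⟩
          obtain rfl : g' = g := congrArg Prod.fst (@he (g', j) (g, i) hj)
          exact hg hg'
        rw [hP', hP, Circuit.map_run_ket_eq (b := B' ω ∘ e g)]
        · congr 1
          funext q
          by_cases hq : ∃ i, e g i = q
          · obtain ⟨i, rfl⟩ := hq
            rw [(heg g).extend_apply, if_pos ⟨g, Finset.mem_insert_self _ _, i, rfl⟩]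
            rfl
          · rw [Function.extend_apply' _ _ _ hq]
            refine if_congr ⟨?_, ?_⟩ rfl rfl
            · rintro ⟨g', hg', h⟩
              exact ⟨g', Finset.mem_insert_of_mem hg', h⟩
            · rintro ⟨g', hg', h⟩
              rcases Finset.mem_insert.1 hg' with rfl | hg'
              · exact absurd h hq
              · exact ⟨g', hg', h⟩
        · rw [← hC g ω]
          congr 2
          funext i
          simp only [Function.comp_apply, if_neg (hnot i)]
  obtain ⟨P, hPD, -, hP⟩ := key Finset.univ
  refine ⟨P, hPD, fun ω => ?_⟩
  rw [hP]
  congr 1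
  funext q
  split_ifs with hq
  · rfl
  · refine (hoff ω q fun g i hgi => hq ⟨g, Finset.mem_univ _, i, hgi⟩).symm

end Reach

/-! ### Elementary reversible gates -/

section Gadgets

/-- The controlled `W`; the first qubit is the target, the second one the control. -/
def ctrl (W : unitaryGroup (Fin 2) ℂ) : unitaryGroup (Fin 2 × Fin 2) ℂ :=
  ⟨blockDiagonal ![1, (W : Matrix (Fin 2) (Fin 2) ℂ)], by
    rw [mem_unitaryGroup_iff, star_eq_conjTranspose, blockDiagonal_conjTranspose,
      ← blockDiagonal_mul, ← blockDiagonal_one]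
    congr 1
    funext i
    fin_cases i
    · simp
    · exact mem_unitaryGroup_iff.1 W.2⟩

variable {ι κ : Type} [Fintype ι] [DecidableEq ι] [Fintype κ] [DecidableEq κ]

theorem ctrl_apply (W : unitaryGroup (Fin 2) ℂ) {t c : ι} (h : t ≠ c) (v : Ket ι)
    (x : ι → Fin 2) :
    (Gate.double t c h (ctrl W)).apply v x
      = if x c = 0 then v x
        else ∑ b, (W : Matrix (Fin 2) (Fin 2) ℂ) (x t) b * v (Function.update x t b) := by
  simp only [Gate.apply, ctrl, blockDiagonal_apply, Fintype.sum_prod_type, ite_mul, zero_mul,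
    Finset.sum_ite_eq, Finset.mem_univ, if_true]
  have hu (b : Fin 2) : Function.update (Function.update x t b) c (x c) = Function.update x t b := by
    rw [Function.update_eq_iff]
    simp [h.symm]
  simp only [hu]
  split_ifs with hc
  · simp [hc, Matrix.one_apply]
  · have hc1 : x c = 1 := by omega
    simp [hc1]

/-- The NOT gate. -/
def notU : unitaryGroup (Fin 2) ℂ :=
  ⟨!![0, 1; 1, 0], by
    rw [mem_unitaryGroup_iff]
    ext i j; fin_cases i <;> fin_cases j <;> simp [star_eq_conjTranspose, Matrix.mul_apply]⟩

theorem notU_sum (a : Fin 2) (f : Fin 2 → ℂ) :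
    ∑ b, (notU : Matrix (Fin 2) (Fin 2) ℂ) a b * f b = f (a + 1) := by
  fin_cases a <;> simp [notU]

/-- A square root of the NOT gate. -/
noncomputable def sqrtNotU : unitaryGroup (Fin 2) ℂ :=
  ⟨!![(1 + Complex.I) / 2, (1 - Complex.I) / 2; (1 - Complex.I) / 2, (1 + Complex.I) / 2], by
    rw [mem_unitaryGroup_iff]
    ext i j
    fin_cases i <;> fin_cases j <;>
      simp [star_eq_conjTranspose, Matrix.mul_apply] <;>
      ring_nf <;> simp [Complex.I_sq, map_ofNat] <;> norm_num⟩

theorem sqrtNotU_mul_self : sqrtNotU * sqrtNotU = notU := by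
  ext i j
  rw [UnitaryGroup.mul_val]
  fin_cases i <;> fin_cases j <;>
    simp [sqrtNotU, notU, Matrix.mul_apply] <;> ring_nf <;> simp [Complex.I_sq] <;> norm_num

/-- A circuit with one gate. -/
def oneGate (g : Gate ι) : Layer ι := ⟨[g], List.pairwise_singleton _ _⟩

theorem reach_not : Reach 1 (fun b : Fin 1 → Fin 2 => b) (fun b => ![b 0 + 1]) := by
  refine ⟨[oneGate (.single 0 notU)], le_rfl, fun b => ?_⟩
  funext x
  change ∑ c : Fin 2, (notU : Matrix (Fin 2) (Fin 2) ℂ) (x 0) c * ket b (Function.update x 0 c) = _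
  rw [notU_sum]
  refine if_congr ?_ rfl rfl
  simp only [funext_iff, Fin.forall_fin_one, Function.update_self, Matrix.cons_val_zero]
  omega

theorem reach_cnot : Reach 1 (fun b : Fin 2 → Fin 2 => b) (fun b => ![b 0, b 1 + b 0]) := by
  refine ⟨[oneGate (.double 1 0 (by decide) (ctrl notU))], le_rfl, fun b => ?_⟩
  funext x
  change (Gate.double 1 0 (by decide) (ctrl notU)).apply (ket b) x = _
  rw [ctrl_apply, notU_sum]
  simp only [ket, funext_iff, Fin.forall_fin_two, Function.update_self, Matrix.cons_val_zero,
    Matrix.cons_val_one, ne_eq, zero_ne_one, not_false_eq_true, Function.update_of_ne]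
  split_ifs <;> first | rfl | omega

/-- The vector `|a⟩|b⟩|φ⟩` of three qubits. -/
def ctrlKet (a b : Fin 2) (φ : Fin 2 → ℂ) : Ket (Fin 3) :=
  fun x => if x 0 = a ∧ x 1 = b then φ (x 2) else 0

/-- The qubit `0` controls a gate on the qubit `2`. -/
theorem ctrlKet_zero_two (W : unitaryGroup (Fin 2) ℂ) (a b : Fin 2) (φ : Fin 2 → ℂ) :
    (Gate.double 2 0 (by decide) (ctrl W)).apply (ctrlKet a b φ)
      = ctrlKet a b (if a = 0 then φ else (W : Matrix (Fin 2) (Fin 2) ℂ) *ᵥ φ) := by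
  funext x
  rw [ctrl_apply]
  simp only [ctrlKet, Function.update_self, ne_eq, Fin.reduceEq, not_false_eq_true,
    Function.update_of_ne]
  by_cases h : x 0 = a ∧ x 1 = b
  · obtain ⟨rfl, rfl⟩ := h
    simp only [and_self, if_true]
    split_ifs <;> rfl
  · simp [h]

/-- The qubit `1` controls a gate on the qubit `2`. -/
theorem ctrlKet_one_two (W : unitaryGroup (Fin 2) ℂ) (a b : Fin 2) (φ : Fin 2 → ℂ) :
    (Gate.double 2 1 (by decide) (ctrl W)).apply (ctrlKet a b φ)
      = ctrlKet a b (if b = 0 then φ else (W : Matrix (Fin 2) (Fin 2) ℂ) *ᵥ φ) := by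
  funext x
  rw [ctrl_apply]
  simp only [ctrlKet, Function.update_self, ne_eq, Fin.reduceEq, not_false_eq_true,
    Function.update_of_ne]
  by_cases h : x 0 = a ∧ x 1 = b
  · obtain ⟨rfl, rfl⟩ := h
    simp only [and_self, if_true]
    split_ifs <;> rfl
  · simp [h]

theorem ctrlKet_zero_one (a b : Fin 2) (φ : Fin 2 → ℂ) :
    (Gate.double 1 0 (by decide) (ctrl notU)).apply (ctrlKet a b φ)
      = ctrlKet a (b + a) φ := by
  funext x
  rw [ctrl_apply, notU_sum]
  simp only [ctrlKet, Function.update_self, ne_eq, Fin.reduceEq, not_false_eq_true,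
    Function.update_of_ne]
  split_ifs <;> first | rfl | omega

theorem ctrlKet_single_eq_ket (b : Fin 3 → Fin 2) :
    ctrlKet (b 0) (b 1) (Pi.single (b 2) 1) = ket b := by
  funext x
  simp only [ctrlKet, ket, funext_iff, Fin.forall_fin_succ, Pi.single_apply, ← ite_and]
  refine if_congr ?_ rfl rfl
  simp [and_assoc]

/-- The Toffoli gate from five two-qubit gates: with `V² = NOT`, the target undergoes
`V ^ b`, `V ^ (-(a ⊕ b))` and `V ^ a`, in total `V ^ (2ab)`. -/
theorem reach_toffoli :
    Reach 5 (fun b : Fin 3 → Fin 2 => b) (fun b => ![b 0, b 1, b 2 + b 0 * b 1]) := by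
  refine ⟨[oneGate (.double 2 1 (by decide) (ctrl sqrtNotU)),
    oneGate (.double 1 0 (by decide) (ctrl notU)),
    oneGate (.double 2 1 (by decide) (ctrl sqrtNotU⁻¹)),
    oneGate (.double 1 0 (by decide) (ctrl notU)),
    oneGate (.double 2 0 (by decide) (ctrl sqrtNotU))], le_rfl, fun b => ?_⟩
  change (Gate.double 2 0 (by decide) (ctrl sqrtNotU)).apply ((Gate.double 1 0 (by decide) (ctrl notU)).apply
    ((Gate.double 2 1 (by decide) (ctrl sqrtNotU⁻¹)).apply ((Gate.double 1 0 (by decide) (ctrl notU)).apply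
    ((Gate.double 2 1 (by decide) (ctrl sqrtNotU)).apply (ket b))))) = _
  rw [← ctrlKet_single_eq_ket, ctrlKet_one_two, ctrlKet_zero_one, ctrlKet_one_two,
    ctrlKet_zero_one, ctrlKet_zero_two, ← ctrlKet_single_eq_ket]
  have h1 (φ : Fin 2 → ℂ) : (↑(sqrtNotU⁻¹) : Matrix (Fin 2) (Fin 2) ℂ) *ᵥ
      ((sqrtNotU : Matrix (Fin 2) (Fin 2) ℂ) *ᵥ φ) = φ := by
    rw [mulVec_mulVec, ← UnitaryGroup.mul_val, inv_mul_cancel, UnitaryGroup.one_val, one_mulVec]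
  have h2 (φ : Fin 2 → ℂ) : (sqrtNotU : Matrix (Fin 2) (Fin 2) ℂ) *ᵥ
      ((↑(sqrtNotU⁻¹) : Matrix (Fin 2) (Fin 2) ℂ) *ᵥ φ) = φ := by
    rw [mulVec_mulVec, ← UnitaryGroup.mul_val, mul_inv_cancel, UnitaryGroup.one_val, one_mulVec]
  have h3 (c : Fin 2) : (sqrtNotU : Matrix (Fin 2) (Fin 2) ℂ) *ᵥ
      ((sqrtNotU : Matrix (Fin 2) (Fin 2) ℂ) *ᵥ Pi.single c 1) = Pi.single (c + 1) 1 := by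
    rw [mulVec_mulVec, ← UnitaryGroup.mul_val, sqrtNotU_mul_self]
    funext a
    refine (notU_sum a _).trans ?_
    simp only [Pi.single_apply]
    exact if_congr (by omega) rfl rfl
  have hab : b 1 + b 0 + b 0 = b 1 := by omega
  have hc (a : Fin 2) : a = 0 ∨ a = 1 := by omega
  simp only [hab, Matrix.cons_val_zero, Matrix.cons_val_one, Matrix.cons_val_two,
    Matrix.head_cons, Matrix.tail_cons]
  congr 1
  rcases hc (b 0) with h | h <;> rcases hc (b 1) with h' | h' <;>
    simp only [h, h', add_zero, zero_add, mul_zero, mul_one, one_ne_zero, reduceIte,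
      h1, h2, h3, Fin.isValue, Fin.reduceAdd]

/-- Two CNOT gates, in the depth of the Toffoli gate so that both serve as tree operations. -/
theorem reach_xor :
    Reach 5 (fun b : Fin 3 → Fin 2 => b) (fun b => ![b 0, b 1, b 2 + (b 0 + b 1)]) := by
  refine ⟨[oneGate (.double 2 0 (by decide) (ctrl notU)),
    oneGate (.double 2 1 (by decide) (ctrl notU))], by simp [Circuit.depth], fun b => ?_⟩
  change (Gate.double 2 1 (by decide) (ctrl notU)).apply ((Gate.double 2 0 (by decide) (ctrl notU)).apply (ket b)) = _
  rw [← ctrlKet_single_eq_ket, ctrlKet_zero_two, ctrlKet_one_two, ← ctrlKet_single_eq_ket]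
  have h3 (c : Fin 2) : (notU : Matrix (Fin 2) (Fin 2) ℂ) *ᵥ Pi.single c 1
      = Pi.single (c + 1) 1 := by
    funext a
    refine (notU_sum a _).trans ?_
    simp only [Pi.single_apply]
    exact if_congr (by omega) rfl rfl
  have hc (a : Fin 2) : a = 0 ∨ a = 1 := by omega
  congr 1
  rcases hc (b 0) with h | h <;> rcases hc (b 1) with h' | h' <;>
    simp [h, h', h3, add_assoc]

variable {Ω G : Type} [Finite G] {D : ℕ} {B B' : Ω → κ → Fin 2}

/-- A layer of CNOT gates. -/
theorem Reach.cnots (c t : G → κ) (hc : Function.Injective c) (ht : Function.Injective t)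
    (hct : ∀ g g', c g ≠ t g') (h : ∀ ω g, B' ω (t g) = B ω (t g) + B ω (c g))
    (hoff : ∀ ω q, (∀ g, t g ≠ q) → B' ω q = B ω q) : Reach 1 B B' := by
  refine Reach.parallel (fun g => ![c g, t g]) ?_ (fun g => ?_) (fun ω q hq => ?_)
  · rintro ⟨g, i⟩ ⟨g', i'⟩ hgi
    fin_cases i <;> fin_cases i'
    · exact Prod.ext (hc hgi) rfl
    · exact absurd hgi (hct _ _)
    · exact absurd hgi.symm (hct _ _)
    · exact Prod.ext (ht hgi) rfl
  · refine (reach_cnot.comp fun ω => B ω ∘ ![c g, t g]).of_eq (fun ω => rfl) fun ω => ?_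
    funext i
    fin_cases i
    · exact hoff ω _ fun g' => (hct _ _).symm
    · exact h ω g
  · exact hoff ω q fun g => hq g 1

/-- A layer of NOT gates. -/
theorem Reach.nots (t : G → κ) (ht : Function.Injective t)
    (h : ∀ ω g, B' ω (t g) = B ω (t g) + 1)
    (hoff : ∀ ω q, (∀ g, t g ≠ q) → B' ω q = B ω q) : Reach 1 B B' := by
  refine Reach.parallel (fun g => ![t g]) ?_ (fun g => ?_) (fun ω q hq => ?_)
  · rintro ⟨g, i⟩ ⟨g', i'⟩ hgi
    fin_cases i; fin_cases i'
    exact Prod.ext (ht hgi) rfl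
  · refine (reach_not.comp fun ω => B ω ∘ ![t g]).of_eq (fun ω => rfl) fun ω => ?_
    funext i
    fin_cases i
    exact h ω g
  · exact hoff ω q fun g => hq g 0

/-- Local computations on disjoint parts of a register, with the resulting states. -/
theorem Reach.parallel_extend (e : G → ι → κ) (he : Function.Injective fun p : G × ι => e p.1 p.2)
    (b' : G → Ω → ι → Fin 2) (h : ∀ g, Reach D (fun ω => B ω ∘ e g) (b' g)) :
    Reach D B (fun ω => Function.extend (fun p : G × ι => e p.1 p.2)
      (fun p => b' p.1 ω p.2) (B ω)) := by
  refine Reach.parallel e he (fun g => ?_) (fun ω q hq => ?_)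
  · convert h g using 1
    funext ω i
    exact he.extend_apply _ _ (g, i)
  · exact Function.extend_apply' _ _ _ fun ⟨p, hp⟩ => hq p.1 p.2 hp

end Gadgets

/-! ### Copying and evaluating in logarithmic depth -/

section Trees
variable {Ω G κ : Type} [Fintype κ] [DecidableEq κ] [Finite G]

/-- The number of copies of a bit doubles in each layer. -/
theorem reach_copies (N : ℕ) (y : Ω → Fin 2) (h : ℕ) :
    Reach h (fun ω (p : Fin N) => if (p : ℕ) < 1 then y ω else 0)
      (fun ω (p : Fin N) => if (p : ℕ) < 2 ^ h then y ω else 0) := by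
  induction h with
  | zero => exact Reach.refl _
  | succ h ih =>
    refine ih.trans (Reach.cnots (G := {p : Fin N // (p : ℕ) < 2 ^ h ∧ (p : ℕ) + 2 ^ h < N})
      (fun p => p.1) (fun p => ⟨(p.1 : ℕ) + 2 ^ h, p.2.2⟩) Subtype.val_injective ?_ ?_ ?_ ?_)
    · intro p p' hp
      have := congrArg Fin.val hp
      exact Subtype.ext (Fin.ext (by simpa using this))
    · intro p p' hp
      have := congrArg Fin.val hp
      have := p.2.1
      dsimp only at *
      omega
    · rintro ω ⟨p, hp, hp'⟩
      have h1 : (p : ℕ) + 2 ^ h < 2 ^ (h + 1) := by rw [pow_succ]; omega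
      simp only [h1, if_true, hp, show ¬(p : ℕ) + 2 ^ h < 2 ^ h by omega, if_false, zero_add]
    · intro ω q hq
      have h1 : (q : ℕ) < 2 ^ (h + 1) ↔ (q : ℕ) < 2 ^ h := by
        refine ⟨fun h2 => ?_, fun h2 => h2.trans_le (Nat.pow_le_pow_right two_pos (Nat.le_succ h))⟩
        by_contra h3
        rw [pow_succ] at h2
        refine hq ⟨⟨(q : ℕ) - 2 ^ h, by omega⟩, by dsimp only; omega, by dsimp only; omega⟩ ?_
        exact Fin.ext (by dsimp only; omega)
      simp only [h1]

/-- Copying, for all `g` at once, the bit `src g` to `N` empty cells. -/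
theorem Reach.copy {N : ℕ} (hN : 1 ≤ N) (src : G → κ) (cell : G → Fin N → κ)
    (hsrc : Function.Injective src) (hcell : Function.Injective fun p : G × Fin N => cell p.1 p.2)
    (hsc : ∀ g g' i, src g ≠ cell g' i) {B B' : Ω → κ → Fin 2}
    (h0 : ∀ ω g i, B ω (cell g i) = 0) (h : ∀ ω g i, B' ω (cell g i) = B ω (src g))
    (hoff : ∀ ω q, (∀ g i, cell g i ≠ q) → B' ω q = B ω q) :
    Reach (1 + Nat.clog 2 N) B B' := by
  classical
  let M : Ω → κ → Fin 2 := fun ω q =>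
    if ∃ g, cell g ⟨0, hN⟩ = q then B' ω q else B ω q
  have hcell0 (g : G) (i : Fin N) : (∃ g', cell g' ⟨0, hN⟩ = cell g i) ↔ (i : ℕ) < 1 := by
    constructor
    · rintro ⟨g', hg'⟩
      have : ⟨0, hN⟩ = i := congrArg Prod.snd (@hcell (g', ⟨0, hN⟩) (g, i) hg')
      rw [← this]; exact one_pos
    · intro hi
      exact ⟨g, congrArg (cell g) (Fin.ext (by dsimp only; omega))⟩
  have h1 : Reach 1 B M := by
    refine Reach.cnots src (fun g => cell g ⟨0, hN⟩) hsrc ?_ (fun g g' => hsc _ _ _) ?_ ?_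
    · intro g g' hg
      exact congrArg Prod.fst (@hcell (g, ⟨0, hN⟩) (g', ⟨0, hN⟩) hg)
    · intro ω g
      rw [h0, zero_add]
      exact (if_pos ⟨g, rfl⟩).trans (h ω g _)
    · intro ω q hq
      exact if_neg fun ⟨g, hg⟩ => hq g hg
  refine h1.trans (Reach.parallel cell hcell (fun g => ?_) fun ω q hq => ?_)
  · convert reach_copies N (fun ω => B ω (src g)) (Nat.clog 2 N) using 1
    · funext ω i
      exact if_congr (hcell0 g i) (h ω g i) (h0 ω g i)
    · funext ω i
      rw [if_pos (i.2.trans_le (Nat.le_pow_clog one_lt_two N))]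
      exact h ω g i
  · rw [hoff ω q hq]
    exact (if_neg fun ⟨g, hg⟩ => hq g _ hg).symm

/-- The value of the node `i` of a complete binary tree, `h` levels above the leaves, that is
evaluated with the operation `op`. The nodes are numbered as in a heap: the root is `1` and the
children of `i` are `2 * i` and `2 * i + 1`. -/
def treeVal (op : Fin 2 → Fin 2 → Fin 2) (leaf : ℕ → Fin 2) : ℕ → ℕ → Fin 2
  | 0, i => leaf i
  | h + 1, i => op (treeVal op leaf h (2 * i)) (treeVal op leaf h (2 * i + 1))

theorem treeVal_add (leaf : ℕ → Fin 2) (h i : ℕ) :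
    treeVal (· + ·) leaf h i = ∑ m ∈ Finset.range (2 ^ h), leaf (i * 2 ^ h + m) := by
  induction h generalizing i with
  | zero => simp [treeVal]
  | succ h ih =>
    rw [treeVal, ih, ih, pow_succ, mul_two, Finset.sum_range_add]
    congr 1
    · exact Finset.sum_congr rfl fun m _ => congrArg leaf (by ring)
    · exact Finset.sum_congr rfl fun m _ => congrArg leaf (by ring)

theorem treeVal_mul (leaf : ℕ → Fin 2) (h i : ℕ) :
    treeVal (· * ·) leaf h i = 1 ↔ ∀ m < 2 ^ h, leaf (i * 2 ^ h + m) = 1 := by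
  induction h generalizing i with
  | zero => simp [treeVal]
  | succ h ih =>
    have hmul (a b : Fin 2) : a * b = 1 ↔ a = 1 ∧ b = 1 := by revert a b; decide
    rw [treeVal, hmul, ih, ih]
    constructor
    · rintro ⟨h1, h2⟩ m hm
      rw [pow_succ] at hm
      by_cases hm' : m < 2 ^ h
      · convert h1 m hm' using 2; ring
      · convert h2 (m - 2 ^ h) (by omega) using 2
        obtain ⟨m, rfl⟩ := Nat.exists_eq_add_of_le (not_lt.1 hm')
        rw [Nat.add_sub_cancel_left]; ring
    · intro h1
      refine ⟨fun m hm => ?_, fun m hm => ?_⟩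
      · convert h1 m (by rw [pow_succ]; omega) using 2; ring
      · convert h1 (2 ^ h + m) (by rw [pow_succ]; omega) using 2; ring

/-- The contents of the nodes of the tree when the levels from `l` on are evaluated. -/
def treeState (op : Fin 2 → Fin 2 → Fin 2) (k : ℕ) (leaf : ℕ → Fin 2) (l : ℕ) :
    Fin (2 ^ (k + 1)) → Fin 2 :=
  fun i => if 2 ^ l ≤ (i : ℕ) then treeVal op leaf (k - Nat.log 2 i) i else 0

theorem treeState_leaves (op : Fin 2 → Fin 2 → Fin 2) (k : ℕ) (leaf : ℕ → Fin 2)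
    (i : Fin (2 ^ (k + 1))) : treeState op k leaf k i = if 2 ^ k ≤ (i : ℕ) then leaf i else 0 := by
  unfold treeState
  split_ifs with h
  · have : Nat.log 2 i = k := Nat.log_eq_of_pow_le_of_lt_pow h i.2
    rw [this, Nat.sub_self, treeVal]
  · rfl

/-- Each level of a tree is evaluated in constant depth. -/
theorem reach_treeState {op : Fin 2 → Fin 2 → Fin 2} {r : ℕ}
    (hop : Reach r (fun b : Fin 3 → Fin 2 => b) (fun b => ![b 0, b 1, b 2 + op (b 0) (b 1)]))
    (k : ℕ) (leaf : Ω → ℕ → Fin 2) (s : ℕ) (hs : s ≤ k) :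
    Reach (r * s) (fun ω => treeState op k (leaf ω) k) (fun ω => treeState op k (leaf ω) (k - s)) := by
  induction s with
  | zero => exact Reach.refl _
  | succ s ih =>
    refine (ih (by omega)).trans ?_
    obtain ⟨l, hl⟩ : ∃ l, k - s = l + 1 := ⟨k - s - 1, by omega⟩
    have hl' : k - (s + 1) = l := by omega
    rw [hl, hl']
    have hpow : 2 ^ (l + 1) = 2 * 2 ^ l := pow_succ' 2 l
    have hpow' : 2 * 2 ^ (l + 1) ≤ 2 ^ (k + 1) := by
      rw [← pow_succ']; exact Nat.pow_le_pow_right two_pos (by omega)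
    have hlog (i : ℕ) (h1 : 2 ^ l ≤ i) (h2 : i < 2 ^ (l + 1)) : Nat.log 2 i = l :=
      Nat.log_eq_of_pow_le_of_lt_pow h1 h2
    refine Reach.parallel (G := Fin (2 ^ l)) (fun p => ![⟨2 * (2 ^ l + p), by have := p.2; omega⟩,
      ⟨2 * (2 ^ l + p) + 1, by have := p.2; omega⟩, ⟨2 ^ l + p, by have := p.2; omega⟩]) ?_ ?_ ?_
    · rintro ⟨p, i⟩ ⟨p', i'⟩ hpi
      have hp := p.2
      have hp' := p'.2
      have := congrArg Fin.val hpi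
      fin_cases i <;> fin_cases i' <;> simp at this <;>
        first
          | omega
          | exact Prod.ext (Fin.ext (by dsimp only; omega)) rfl
    · intro p
      refine (hop.comp fun ω => treeState op k (leaf ω) (l + 1) ∘
        ![⟨2 * (2 ^ l + p), by have := p.2; omega⟩,
        ⟨2 * (2 ^ l + p) + 1, by have := p.2; omega⟩,
        ⟨2 ^ l + p, by have := p.2; omega⟩]).of_eq (fun ω => rfl) fun ω => ?_
      funext i
      have hp := p.2
      have h0 : k - l = (k - (l + 1)) + 1 := by omega
      have hl1 : Nat.log 2 (2 * (2 ^ l + p)) = l + 1 :=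
        Nat.log_eq_of_pow_le_of_lt_pow (by omega) (by rw [pow_succ']; omega)
      have hl2 : Nat.log 2 (2 * (2 ^ l + p) + 1) = l + 1 :=
        Nat.log_eq_of_pow_le_of_lt_pow (by omega) (by rw [pow_succ']; omega)
      have hl3 : Nat.log 2 (2 ^ l + p) = l := hlog _ (by omega) (by omega)
      have hs1 : treeState op k (leaf ω) (l + 1) ⟨2 * (2 ^ l + p), by omega⟩
          = treeVal op (leaf ω) (k - (l + 1)) (2 * (2 ^ l + p)) := by
        simp only [treeState, hl1]; exact if_pos (by omega)
      have hs2 : treeState op k (leaf ω) (l + 1) ⟨2 * (2 ^ l + p) + 1, by omega⟩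
          = treeVal op (leaf ω) (k - (l + 1)) (2 * (2 ^ l + p) + 1) := by
        simp only [treeState, hl2]; exact if_pos (by omega)
      have hs3 : treeState op k (leaf ω) (l + 1) ⟨2 ^ l + p, by omega⟩ = 0 :=
        if_neg (by dsimp only; omega)
      have hs4 : treeState op k (leaf ω) l ⟨2 * (2 ^ l + p), by omega⟩
          = treeVal op (leaf ω) (k - (l + 1)) (2 * (2 ^ l + p)) := by
        simp only [treeState, hl1]; exact if_pos (by omega)
      have hs5 : treeState op k (leaf ω) l ⟨2 * (2 ^ l + p) + 1, by omega⟩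
          = treeVal op (leaf ω) (k - (l + 1)) (2 * (2 ^ l + p) + 1) := by
        simp only [treeState, hl2]; exact if_pos (by omega)
      have hs6 : treeState op k (leaf ω) l ⟨2 ^ l + p, by omega⟩
          = op (treeVal op (leaf ω) (k - (l + 1)) (2 * (2 ^ l + p)))
            (treeVal op (leaf ω) (k - (l + 1)) (2 * (2 ^ l + p) + 1)) := by
        simp only [treeState, hl3, h0, treeVal]; exact if_pos (by omega)
      fin_cases i
      · exact hs4.trans hs1.symm
      · exact hs5.trans hs2.symm
      · simp [hs1, hs2, hs3, hs6]
    · intro ω q hq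
      unfold treeState
      refine if_congr ⟨fun h1 => ?_, fun h1 => by omega⟩ rfl rfl
      by_contra h2
      refine hq ⟨(q : ℕ) - 2 ^ l, by omega⟩ 2 (Fin.ext ?_)
      simp only [Matrix.cons_val]
      omega

/-- Adding, for all `g` at once, the value at the root of the tree `node g` to the bit `tgt g`. The
inner nodes are empty before and after. -/
theorem Reach.tree {op : Fin 2 → Fin 2 → Fin 2} {r : ℕ}
    (hop : Reach r (fun b : Fin 3 → Fin 2 => b) (fun b => ![b 0, b 1, b 2 + op (b 0) (b 1)]))
    {k : ℕ} (node : G → Fin (2 ^ (k + 1)) → κ) (tgt : G → κ)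
    (hnode : Function.Injective fun p : G × Fin (2 ^ (k + 1)) => node p.1 p.2)
    (htgt : Function.Injective tgt) (hnt : ∀ g i g', node g i ≠ tgt g')
    (leaf : G → Ω → ℕ → Fin 2) {B B' : Ω → κ → Fin 2}
    (hB : ∀ ω g i, B ω (node g i) = if 2 ^ k ≤ (i : ℕ) then leaf g ω i else 0)
    (h : ∀ ω g, B' ω (tgt g) = B ω (tgt g) + treeVal op (leaf g ω) k 1)
    (hoff : ∀ ω q, (∀ g, tgt g ≠ q) → B' ω q = B ω q) :
    Reach (r * k + 1 + r * k) B B' := by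
  have hup (E : Ω → κ → Fin 2)
      (hE : ∀ ω g i, E ω (node g i) = if 2 ^ k ≤ (i : ℕ) then leaf g ω i else 0) :
      Reach (r * k) E (fun ω => Function.extend (fun p : G × Fin (2 ^ (k + 1)) => node p.1 p.2)
        (fun p => treeState op k (leaf p.1 ω) 0 p.2) (E ω)) := by
    refine Reach.parallel_extend node hnode (fun g ω => treeState op k (leaf g ω) 0) fun g => ?_
    convert reach_treeState hop k (leaf g) k le_rfl using 1
    · funext ω i
      rw [treeState_leaves]
      exact hE ω g i
    · simp
  have hroot : 1 < 2 ^ (k + 1) := Nat.one_lt_two_pow (Nat.succ_ne_zero k)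
  have hnot (g : G) : ¬∃ p : G × Fin (2 ^ (k + 1)), node p.1 p.2 = tgt g :=
    fun ⟨p, hp⟩ => hnt _ _ _ hp
  refine ((hup B hB).trans ?_).trans (hup B' fun ω g i => ?_).symm
  · refine Reach.cnots (fun g => node g ⟨1, hroot⟩) tgt (fun g g' hg => ?_) htgt
      (fun g g' => hnt _ _ _) (fun ω g => ?_) (fun ω q hq => ?_)
    · exact congrArg Prod.fst (@hnode (g, ⟨1, hroot⟩) (g', ⟨1, hroot⟩) hg)
    · rw [Function.extend_apply' _ _ _ (hnot g), Function.extend_apply' _ _ _ (hnot g), h]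
      congr 1
      refine ((hnode.extend_apply _ _ (g, ⟨1, hroot⟩)).trans ?_).symm
      simp [treeState]
    · by_cases hp : ∃ p : G × Fin (2 ^ (k + 1)), node p.1 p.2 = q
      · obtain ⟨p, rfl⟩ := hp
        exact (hnode.extend_apply _ _ p).trans
          (hnode.extend_apply (fun p => treeState op k (leaf p.1 ω) 0 p.2) (B ω) p).symm
      · rw [Function.extend_apply' _ _ _ hp, Function.extend_apply' _ _ _ hp]
        exact hoff ω q hq
  · rw [hoff ω _ fun g' => (hnt _ _ _).symm, hB]

end Trees

/-! ### Superpositions of one-hot basis states -/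

section OneHot
variable {ι : Type} [Fintype ι] [DecidableEq ι]

/-- The two-qubit unitary that fixes `|00⟩` and `|11⟩` and maps `|10⟩` to `u|10⟩ + v|01⟩`. -/
noncomputable def splitU (u v : ℂ) (h : ‖u‖ ^ 2 + ‖v‖ ^ 2 = 1) : unitaryGroup (Fin 2 × Fin 2) ℂ :=
  ⟨of fun p q =>
    if q = (1, 0) then (if p = (1, 0) then u else if p = (0, 1) then v else 0)
    else if q = (0, 1) then
      (if p = (1, 0) then -(starRingEnd ℂ) v else if p = (0, 1) then (starRingEnd ℂ) u else 0)
    else if p = q then 1 else 0, by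
    have h1 : (starRingEnd ℂ) u * u + (starRingEnd ℂ) v * v = 1 := by
      rw [Complex.conj_mul', Complex.conj_mul']; exact_mod_cast h
    rw [mem_unitaryGroup_iff', star_eq_conjTranspose]
    ext ⟨i, i'⟩ ⟨j, j'⟩
    rw [Matrix.mul_apply, Fintype.sum_prod_type]
    fin_cases i <;> fin_cases i' <;> fin_cases j <;> fin_cases j' <;>
      simp <;> first | linear_combination h1 | ring⟩

theorem Gate.double_mulVec_ket {i j : ι} (hij : i ≠ j) (U : unitaryGroup (Fin 2 × Fin 2) ℂ)
    (b : ι → Fin 2) : (Gate.double i j hij U).mat *ᵥ ket b = fun x =>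
      if ∀ q, q ≠ i → q ≠ j → x q = b q then
        (U : Matrix (Fin 2 × Fin 2) (Fin 2 × Fin 2) ℂ) (x i, x j) (b i, b j) else 0 := by
  funext x
  simp only [mulVec, dotProduct, ket, mul_ite, mul_one, mul_zero, Finset.sum_ite_eq',
    Finset.mem_univ, if_true]
  rfl

theorem splitU_mulVec_ket_of_zero {u v : ℂ} (h : ‖u‖ ^ 2 + ‖v‖ ^ 2 = 1) {i j : ι} (hij : i ≠ j)
    {b : ι → Fin 2} (hi : b i = 0) (hj : b j = 0) :
    (Gate.double i j hij (splitU u v h)).mat *ᵥ ket b = ket b := by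
  rw [Gate.double_mulVec_ket]
  funext x
  simp only [splitU, of_apply, hi, hj, Prod.mk.injEq, zero_ne_one, and_false, false_and, if_false,
    ← ite_and, ket]
  refine if_congr ⟨?_, ?_⟩ rfl rfl
  · rintro ⟨h1, h2, h3⟩
    funext q
    by_cases hqi : q = i
    · rw [hqi, h2, hi]
    · by_cases hqj : q = j
      · rw [hqj, h3, hj]
      · exact h1 q hqi hqj
  · rintro rfl
    exact ⟨fun _ _ _ => rfl, hi, hj⟩

theorem splitU_mulVec_single {u v : ℂ} (h : ‖u‖ ^ 2 + ‖v‖ ^ 2 = 1) {i j : ι} (hij : i ≠ j) :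
    (Gate.double i j hij (splitU u v h)).mat *ᵥ ket (Pi.single i 1)
      = u • ket (Pi.single i 1) + v • ket (Pi.single j 1) := by
  rw [Gate.double_mulVec_ket]
  funext x
  simp only [splitU, of_apply, Pi.single_eq_same, Pi.single_eq_of_ne hij.symm, if_true, ket,
    Pi.add_apply, Pi.smul_apply, smul_eq_mul, mul_ite, mul_one, mul_zero, Prod.mk.injEq]
  have hx (a : ι) (ha : a = i ∨ a = j) : x = Pi.single a 1 ↔
      (∀ q, q ≠ i → q ≠ j → x q = (Pi.single i 1 : ι → Fin 2) q) ∧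
        x i = (Pi.single a 1 : ι → Fin 2) i ∧ x j = (Pi.single a 1 : ι → Fin 2) j := by
    constructor
    · rintro rfl
      refine ⟨fun q hi hj => ?_, rfl, rfl⟩
      rw [Pi.single_eq_of_ne hi, Pi.single_eq_of_ne]
      rcases ha with rfl | rfl <;> assumption
    · rintro ⟨h1, h2, h3⟩
      funext q
      by_cases hqi : q = i
      · rw [hqi, h2]
      · by_cases hqj : q = j
        · rw [hqj, h3]
        · rw [h1 q hqi hqj, Pi.single_eq_of_ne hqi, Pi.single_eq_of_ne]
          rcases ha with rfl | rfl <;> assumption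
  have hxi := hx i (Or.inl rfl)
  have hxj := hx j (Or.inr rfl)
  rw [Pi.single_eq_same, Pi.single_eq_of_ne hij.symm] at hxi
  rw [Pi.single_eq_same, Pi.single_eq_of_ne hij] at hxj
  by_cases hc : ∀ q, q ≠ i → q ≠ j → x q = (Pi.single i 1 : ι → Fin 2) q
  · rw [and_iff_right hc] at hxi hxj
    rw [if_pos hc]
    simp only [hxi, hxj]
    by_cases h1 : x i = 1 ∧ x j = 0
    · simp [h1]
    · simp [h1]
  · simp only [hxi, hxj, hc, false_and, if_false, add_zero]

theorem gatesMat_mulVec_of_fixed (l : List (Gate ι)) (w : Ket ι)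
    (h : ∀ g ∈ l, g.mat *ᵥ w = w) : gatesMat l *ᵥ w = w := by
  induction l with
  | nil => simp [gatesMat_nil]
  | cons g l ih =>
    rw [gatesMat_cons, ← mulVec_mulVec, h g List.mem_cons_self,
      ih fun g' hg' => h g' (List.mem_cons_of_mem _ hg')]

/-- If only the gate `q` of a list acts nontrivially on `w` and on its image, the list acts on `w`
as this gate does. -/
theorem gatesMat_mulVec_of_mem {P : Type} (gate : P → Gate ι) {l : List P} (hl : l.Nodup) {q : P}
    (hq : q ∈ l) {w w' : Ket ι} (h : (gate q).mat *ᵥ w = w')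
    (hw : ∀ p, p ≠ q → (gate p).mat *ᵥ w = w) (hw' : ∀ p, p ≠ q → (gate p).mat *ᵥ w' = w') :
    gatesMat (l.map gate) *ᵥ w = w' := by
  obtain ⟨l₁, l₂, rfl⟩ := List.append_of_mem hq
  rw [List.nodup_append] at hl
  have h1 : ∀ p ∈ l₁, p ≠ q := fun p hp => hl.2.2 p hp q List.mem_cons_self
  have h2 : ∀ p ∈ l₂, p ≠ q := fun p hp hpq => (List.nodup_cons.1 hl.2.1).1 (hpq ▸ hp)
  rw [List.map_append, List.map_cons, gatesMat_append, gatesMat_cons, ← mulVec_mulVec,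
    ← mulVec_mulVec, gatesMat_mulVec_of_fixed (l₁.map gate), h, gatesMat_mulVec_of_fixed]
  · intro g hg
    obtain ⟨p, hp, rfl⟩ := List.mem_map.1 hg
    exact hw' p (h2 p hp)
  · intro g hg
    obtain ⟨p, hp, rfl⟩ := List.mem_map.1 hg
    exact hw p (h1 p hp)

theorem exists_split (a b c : ℂ) (h : ‖a‖ ^ 2 + ‖b‖ ^ 2 = ‖c‖ ^ 2) :
    ∃ u v : ℂ, ‖u‖ ^ 2 + ‖v‖ ^ 2 = 1 ∧ c * u = a ∧ c * v = b := by
  by_cases hc : c = 0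
  · subst hc
    rw [norm_zero, zero_pow two_ne_zero] at h
    have ha : ‖a‖ ^ 2 = 0 := by nlinarith [sq_nonneg ‖a‖, sq_nonneg ‖b‖]
    have hb : ‖b‖ ^ 2 = 0 := by nlinarith [sq_nonneg ‖a‖, sq_nonneg ‖b‖]
    rw [pow_eq_zero_iff two_ne_zero, norm_eq_zero] at ha hb
    exact ⟨1, 0, by simp, by simp [ha], by simp [hb]⟩
  · have hc' : ‖c‖ ^ 2 ≠ 0 := pow_ne_zero _ (norm_ne_zero_iff.2 hc)
    refine ⟨a / c, b / c, ?_, mul_div_cancel₀ a hc, mul_div_cancel₀ b hc⟩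
    rw [norm_div, norm_div, div_pow, div_pow, ← add_div, h, div_self hc']

/-- The basis state of `N` qubits with a single one, at position `p < N`. -/
def oneHot (N p : ℕ) : Fin N → Fin 2 := fun q => if (q : ℕ) = p then 1 else 0

theorem oneHot_eq_single {N : ℕ} (p : Fin N) : oneHot N p = Pi.single p 1 := by
  funext q
  simp only [oneHot, Pi.single_apply, Fin.ext_iff]

/-- One layer splits each of `H` amplitudes between the positions `p` and `p + H`. -/
theorem exists_split_layer {N H : ℕ} (hN : H + H ≤ N) (γ γ' : ℕ → ℂ)
    (h : ∀ p < H, ‖γ' p‖ ^ 2 + ‖γ' (p + H)‖ ^ 2 = ‖γ p‖ ^ 2) :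
    ∃ L : Layer (Fin N), L.apply (∑ p ∈ Finset.range H, γ p • ket (oneHot N p))
      = ∑ p ∈ Finset.range (H + H), γ' p • ket (oneHot N p) := by
  choose u v huv hu hv using fun p : Fin H => exists_split _ _ _ (h p p.2)
  let gate : Fin H → Gate (Fin N) := fun p =>
    .double ⟨p, by have := p.2; omega⟩ ⟨p + H, by have := p.2; omega⟩
      (fun hp => by
        have h1 := congrArg Fin.val hp
        have h2 := p.2
        dsimp only at h1; omega) (splitU (u p) (v p) (huv p))
  have hfix (p : Fin H) (q : ℕ) (h1 : q ≠ p) (h2 : q ≠ p + H) :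
      (gate p).mat *ᵥ ket (oneHot N q) = ket (oneHot N q) :=
    splitU_mulVec_ket_of_zero _ _ (if_neg h1.symm) (if_neg h2.symm)
  refine ⟨⟨(List.finRange H).map gate, ?_⟩, ?_⟩
  · rw [List.pairwise_map]
    refine (List.nodup_finRange H).imp fun {p q} hpq => ?_
    have hp := p.2
    have hq := q.2
    have hpq' : (p : ℕ) ≠ q := fun h => hpq (Fin.ext h)
    rw [Set.disjoint_left]
    rintro x (rfl | rfl) (hx | hx) <;> have := congrArg Fin.val hx <;> dsimp only at this <;> omega
  · rw [Layer.apply_eq_mulVec, mulVec_sum, Finset.sum_range_add, ← Finset.sum_add_distrib]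
    refine Finset.sum_congr rfl fun q hq => ?_
    rw [Finset.mem_range] at hq
    rw [mulVec_smul, gatesMat_mulVec_of_mem gate (List.nodup_finRange H)
      (List.mem_finRange ⟨q, hq⟩) (w' := u ⟨q, hq⟩ • ket (oneHot N q)
        + v ⟨q, hq⟩ • ket (oneHot N (q + H)))]
    · have hu' : γ q * u ⟨q, hq⟩ = γ' q := hu ⟨q, hq⟩
      have hv' : γ q * v ⟨q, hq⟩ = γ' (q + H) := hv ⟨q, hq⟩
      rw [smul_add, smul_smul, smul_smul, hu', hv', add_comm H q]
    · have h1 := splitU_mulVec_single (huv ⟨q, hq⟩) (i := (⟨q, by omega⟩ : Fin N))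
        (j := ⟨q + H, by omega⟩) (fun hp => by
          have h1 := congrArg Fin.val hp
          dsimp only at h1; omega)
      rw [← oneHot_eq_single, ← oneHot_eq_single] at h1
      exact h1
    · intro p hp
      have hp' : q ≠ p := fun h => hp (Fin.ext h.symm)
      exact hfix p q hp' (by omega)
    · intro p hp
      have hp' : q ≠ p := fun h => hp (Fin.ext h.symm)
      have := p.2
      rw [mulVec_add, mulVec_smul, mulVec_smul, hfix p q hp' (by omega),
        hfix p (q + H) (by omega) (by omega)]

/-- The total weight of the positions `p + m * 2 ^ (k - r)`, `m < 2 ^ r`. -/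
noncomputable def blockWeight (k : ℕ) (α : ℕ → ℂ) : ℕ → ℕ → ℝ
  | 0, p => ‖α p‖ ^ 2
  | r + 1, p => blockWeight k α r p + blockWeight k α r (p + 2 ^ (k - (r + 1)))

theorem blockWeight_nonneg (k : ℕ) (α : ℕ → ℂ) (r p : ℕ) : 0 ≤ blockWeight k α r p := by
  induction r generalizing p with
  | zero => exact sq_nonneg _
  | succ r ih => exact add_nonneg (ih _) (ih _)

theorem sum_blockWeight (k : ℕ) (α : ℕ → ℂ) (r : ℕ) (hr : r ≤ k) :
    ∑ p ∈ Finset.range (2 ^ (k - r)), blockWeight k α r p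
      = ∑ p ∈ Finset.range (2 ^ k), ‖α p‖ ^ 2 := by
  induction r with
  | zero => rfl
  | succ r ih =>
    rw [← ih (by omega)]
    have h : k - r = k - (r + 1) + 1 := by omega
    rw [h, pow_succ, mul_two, Finset.sum_range_add, ← Finset.sum_add_distrib]
    exact Finset.sum_congr rfl fun p _ => by rw [blockWeight, add_comm p]

/-- A superposition of one-hot states is prepared by halving the blocks of positions repeatedly. -/
theorem exists_circuit_oneHot {k : ℕ} (hk : 1 ≤ k) (α : Fin (2 ^ k) → ℂ)
    (hα : ∑ j, ‖α j‖ ^ 2 = 1) :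
    ∃ C : Circuit (Fin (2 ^ k)), C.depth ≤ k + 1 ∧
      C.run (ket 0) = ∑ j, α j • ket (Pi.single j 1) := by
  let α' : ℕ → ℂ := fun p => if h : p < 2 ^ k then α ⟨p, h⟩ else 0
  have hα' (p : Fin (2 ^ k)) : α' p = α p := dif_pos p.2
  -- the amplitudes after `h` rounds: real until the last round, which introduces the phases
  let γ : ℕ → ℕ → ℂ := fun h p =>
    if h = k then α' p else (√(blockWeight k α' (k - h) p) : ℝ)
  have hγ (h p : ℕ) : ‖γ h p‖ ^ 2 = blockWeight k α' (k - h) p := by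
    by_cases hh : h = k
    · simp only [γ, if_pos hh]
      rw [hh, Nat.sub_self, blockWeight]
    · simp only [γ, if_neg hh]
      rw [Complex.norm_real, Real.norm_eq_abs, sq_abs, Real.sq_sqrt (blockWeight_nonneg _ _ _ _)]
  have key (h : ℕ) (hh : h ≤ k) : ∃ C : Circuit (Fin (2 ^ k)), C.depth ≤ h + 1 ∧
      C.run (ket 0) = ∑ p ∈ Finset.range (2 ^ h), γ h p • ket (oneHot (2 ^ k) p) := by
    induction h with
    | zero =>
      have hroot : γ 0 0 = 1 := by
        have h1 := sum_blockWeight k α' k le_rfl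
        rw [Nat.sub_self, pow_zero, Finset.sum_range_one, Finset.sum_range] at h1
        simp only [hα', hα] at h1
        simp only [γ]
        rw [if_neg (by omega), Nat.sub_zero, h1, Real.sqrt_one, Complex.ofReal_one]
      have hpos : 0 < 2 ^ k := Nat.two_pow_pos k
      have hnot : Reach 1 (fun _ : Unit => (0 : Fin (2 ^ k) → Fin 2))
          (fun _ => oneHot (2 ^ k) 0) := by
        refine Reach.nots (fun _ : Unit => (⟨0, hpos⟩ : Fin (2 ^ k)))
          (fun _ _ _ => rfl) (fun _ _ => rfl) fun _ q hq => if_neg fun h => ?_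
        exact hq () (Fin.ext h.symm)
      obtain ⟨C, hC, hC'⟩ := hnot
      refine ⟨C, hC, ?_⟩
      rw [hC' (), pow_zero, Finset.sum_range_one, hroot, one_smul]
    | succ h ih =>
      obtain ⟨C, hC, hC'⟩ := ih (by omega)
      obtain ⟨L, hL⟩ := exists_split_layer (N := 2 ^ k) (H := 2 ^ h)
        (by rw [← mul_two, ← pow_succ]; exact Nat.pow_le_pow_right two_pos hh) (γ h) (γ (h + 1))
        (fun p _ => by
          have h1 : k - h = k - (h + 1) + 1 := by omega
          have h2 : k - (k - (h + 1) + 1) = h := by omega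
          rw [hγ, hγ, hγ, h1, blockWeight, h2])
      refine ⟨C ++ [L], ?_, ?_⟩
      · have : Circuit.depth (C ++ [L]) = C.depth + 1 := by simp [Circuit.depth]
        omega
      · rw [Circuit.run_append, hC']
        refine hL.trans ?_
        rw [← mul_two, ← pow_succ]
  obtain ⟨C, hC, hC'⟩ := key k le_rfl
  refine ⟨C, hC, hC'.trans ?_⟩
  rw [Finset.sum_range]
  refine Finset.sum_congr rfl fun j _ => ?_
  rw [oneHot_eq_single]
  simp only [γ, if_true, hα']

end OneHot

/-! ### From one-hot to binary labels -/

section Labels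

/-- The ancillas: a one-hot register of `2 ^ k` qubits, a table of `2 ^ k` rows of `n` copied bits,
a tree with `2 ^ k` leaves for each target, and a tree with `2 ^ m` leaves for each row. -/
abbrev Anc (n k m : ℕ) : Type :=
  Fin (2 ^ k) ⊕ (Fin (2 ^ k) × Fin n) ⊕ (Fin n × Fin (2 ^ (k + 1)))
    ⊕ (Fin (2 ^ k) × Fin (2 ^ (m + 1)))

variable {n k m : ℕ}

/-- The basis state with contents `T` of the targets, `E` of the one-hot register, `c` of the table,
and `X`, `A` of the two families of trees. -/
def regState (T : Fin n → Fin 2) (E : Fin (2 ^ k) → Fin 2) (c : Fin (2 ^ k) × Fin n → Fin 2)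
    (X : Fin n × Fin (2 ^ (k + 1)) → Fin 2) (A : Fin (2 ^ k) × Fin (2 ^ (m + 1)) → Fin 2) :
    Fin n ⊕ Anc n k m → Fin 2 :=
  Sum.elim T (Sum.elim E (Sum.elim c (Sum.elim X A)))

/-- The target qubit `t`. -/
abbrev tgtQ (t : Fin n) : Fin n ⊕ Anc n k m := Sum.inl t
/-- The qubit `j` of the one-hot register. -/
abbrev hotQ (j : Fin (2 ^ k)) : Fin n ⊕ Anc n k m := Sum.inr (Sum.inl j)
/-- The qubit of the table in row `p.1` and column `p.2`. -/
abbrev tabQ (p : Fin (2 ^ k) × Fin n) : Fin n ⊕ Anc n k m := Sum.inr (Sum.inr (Sum.inl p))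
/-- The node `p.2` of the tree of the target `p.1`. -/
abbrev xorQ (p : Fin n × Fin (2 ^ (k + 1))) : Fin n ⊕ Anc n k m :=
  Sum.inr (Sum.inr (Sum.inr (Sum.inl p)))
/-- The node `p.2` of the tree of the row `p.1`. -/
abbrev andQ (p : Fin (2 ^ k) × Fin (2 ^ (m + 1))) : Fin n ⊕ Anc n k m :=
  Sum.inr (Sum.inr (Sum.inr (Sum.inr p)))

variable {Ω : Type}

/-- Copying the one-hot register into the columns of the table. -/
theorem reach_copy_rows (hn : 1 ≤ n) (T : Ω → Fin n → Fin 2) (E : Ω → Fin (2 ^ k) → Fin 2) :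
    Reach (1 + Nat.clog 2 n) (fun ω => regState (m := m) (T ω) (E ω) 0 0 0)
      (fun ω => regState (T ω) (E ω) (fun p => E ω p.1) 0 0) := by
  refine Reach.copy hn hotQ (fun j t => tabQ (j, t)) ?_ ?_ ?_ ?_ ?_ ?_
  · intro j j' h; simpa using h
  · intro p p' h; simpa [Prod.ext_iff] using h
  · intro j j' t h; simp at h
  · intro ω j t; rfl
  · intro ω j t; rfl
  · rintro ω (t | j | p | p | p) hq
    · rfl
    · rfl
    · exact absurd rfl (hq p.1 p.2)
    · rfl
    · rfl

/-- Copying the targets into the rows of the table. -/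
theorem reach_copy_columns (T : Ω → Fin n → Fin 2) (E : Ω → Fin (2 ^ k) → Fin 2) :
    Reach (1 + k) (fun ω => regState (m := m) (T ω) (E ω) 0 0 0)
      (fun ω => regState (T ω) (E ω) (fun p => T ω p.2) 0 0) := by
  have hk : Nat.clog 2 (2 ^ k) = k := Nat.clog_pow 2 k one_lt_two
  rw [← congrArg (1 + ·) hk]
  refine Reach.copy Nat.one_le_two_pow tgtQ (fun t j => tabQ (j, t)) ?_ ?_ ?_ ?_ ?_ ?_
  · intro j j' h; simpa using h
  · intro p p' h
    have h' : p.2 = p'.2 ∧ p.1 = p'.1 := by simpa [Prod.ext_iff] using h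
    exact Prod.ext h'.2 h'.1
  · intro j j' t h; simp at h
  · intro ω j t; rfl
  · intro ω j t; rfl
  · rintro ω (t | j | p | p | p) hq
    · rfl
    · rfl
    · exact absurd rfl (hq p.2 p.1)
    · rfl
    · rfl

variable (xs : Fin (2 ^ k) → Fin n → Fin 2) (idx : Ω → Fin (2 ^ k))

/-- The leaves of the tree of the target `t`, when the one-hot register contains `idx`: the bit `t`
of the label `xs idx` at the leaf `idx`, and zero elsewhere. -/
def xorLeaf (t : Fin n) (ω : Ω) (i : ℕ) : Fin 2 :=
  if i = 2 ^ k + (idx ω : ℕ) then xs (idx ω) t else 0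

theorem treeVal_xorLeaf (t : Fin n) (ω : Ω) :
    treeVal (· + ·) (xorLeaf xs idx t ω) k 1 = xs (idx ω) t := by
  rw [treeVal_add]
  simp only [xorLeaf, one_mul, add_right_inj]
  rw [Finset.sum_ite_eq', if_pos (Finset.mem_range.2 (idx ω).2)]

/-- The contents of the first family of trees before their evaluation. -/
def xorFill (ω : Ω) (p : Fin n × Fin (2 ^ (k + 1))) : Fin 2 :=
  if 2 ^ k ≤ (p.2 : ℕ) then xorLeaf xs idx p.1 ω p.2 else 0

theorem reach_xorFill (T : Ω → Fin n → Fin 2) :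
    Reach 1 (fun ω => regState (m := m) (T ω) (Pi.single (idx ω) 1)
        (fun p => (Pi.single (idx ω) 1 : Fin (2 ^ k) → Fin 2) p.1) 0 0)
      (fun ω => regState (T ω) (Pi.single (idx ω) 1)
        (fun p => (Pi.single (idx ω) 1 : Fin (2 ^ k) → Fin 2) p.1) (xorFill xs idx ω) 0) := by
  have hlt (j : Fin (2 ^ k)) : 2 ^ k + (j : ℕ) < 2 ^ (k + 1) := by
    have := j.2; rw [pow_succ]; omega
  refine Reach.cnots (G := {p : Fin (2 ^ k) × Fin n // xs p.1 p.2 = 1}) (fun p => tabQ p.1)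
    (fun p => xorQ (p.1.2, ⟨2 ^ k + (p.1.1 : ℕ), hlt _⟩)) ?_ ?_ ?_ ?_ ?_
  · intro p p' h
    exact Subtype.ext (by simpa using h)
  · intro p p' h
    have h' : p.1.2 = p'.1.2 ∧ p.1.1 = p'.1.1 := by simpa [Prod.ext_iff, Fin.ext_iff] using h
    exact Subtype.ext (Prod.ext h'.2 h'.1)
  · intro p p' h; simp at h
  · rintro ω ⟨⟨j, t⟩, hp⟩
    change xorFill xs idx ω (t, ⟨2 ^ k + (j : ℕ), hlt j⟩)
      = 0 + (Pi.single (idx ω) 1 : Fin (2 ^ k) → Fin 2) j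
    simp only [xorFill, xorLeaf, Nat.le_add_right, if_true, add_right_inj, zero_add,
      Pi.single_apply, Fin.ext_iff]
    split_ifs with h
    · rw [← Fin.ext h]; exact congrArg Fin.val hp
    · rfl
  · rintro ω (t | j | p | ⟨t, i⟩ | p) hq
    · rfl
    · rfl
    · rfl
    · change xorFill xs idx ω (t, i) = 0
      simp only [xorFill, xorLeaf]
      split_ifs with h1 h2
      · by_contra h3
        have h4 : xs (idx ω) t = 1 := by omega
        exact hq ⟨(idx ω, t), h4⟩ (by
          simp only [Sum.inr.injEq, Sum.inl.injEq, Prod.mk.injEq, true_and]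
          exact Fin.ext h2.symm)
      · rfl
      · rfl
    · rfl

/-- Adding to the targets the label that is selected by the one-hot register. -/
theorem reach_label (hn : 1 ≤ n) :
    Reach (2 * (Nat.clog 2 n + 2) + (10 * k + 1))
      (fun ω => regState (m := m) 0 (Pi.single (idx ω) 1) 0 0 0)
      (fun ω => regState (xs (idx ω)) (Pi.single (idx ω) 1) 0 0 0) := by
  have h1 (T : Ω → Fin n → Fin 2) := (reach_copy_rows (m := m) hn T
    fun ω => Pi.single (idx ω) 1).trans (reach_xorFill xs idx T)
  have h2 : Reach (5 * k + 1 + 5 * k) (fun ω => regState (m := m) 0 (Pi.single (idx ω) 1)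
        (fun p => (Pi.single (idx ω) 1 : Fin (2 ^ k) → Fin 2) p.1) (xorFill xs idx ω) 0)
      (fun ω => regState (xs (idx ω)) (Pi.single (idx ω) 1)
        (fun p => (Pi.single (idx ω) 1 : Fin (2 ^ k) → Fin 2) p.1) (xorFill xs idx ω) 0) := by
    refine Reach.tree reach_xor (fun t i => xorQ (t, i)) tgtQ ?_ ?_ ?_ (xorLeaf xs idx) ?_ ?_ ?_
    · intro p p' h; simpa [Prod.ext_iff] using h
    · intro t t' h; simpa using h
    · intro t i t' h; simp at h
    · intro ω t i; rfl
    · intro ω t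
      rw [treeVal_xorLeaf]
      exact (zero_add _).symm
    · rintro ω (t | j | p | p | p) hq
      · exact absurd rfl (hq t)
      · rfl
      · rfl
      · rfl
      · rfl
  exact (((h1 fun _ => 0).trans h2).trans (h1 fun ω => xs (idx ω)).symm).mono (by omega)

/-- The leaves of the tree of the row `j`: whether a bit of the label `xs (idx ω)` agrees with that
of `xs j`, and one at the unused leaves. -/
def andLeaf (m : ℕ) (j : Fin (2 ^ k)) (ω : Ω) (i : ℕ) : Fin 2 :=
  if h : i - 2 ^ m < n then xs (idx ω) ⟨i - 2 ^ m, h⟩ + xs j ⟨i - 2 ^ m, h⟩ + 1 else 1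

theorem treeVal_andLeaf (hm : n ≤ 2 ^ m) (j : Fin (2 ^ k)) (ω : Ω) :
    treeVal (· * ·) (andLeaf xs idx m j ω) m 1 = if xs j = xs (idx ω) then 1 else 0 := by
  have h : treeVal (· * ·) (andLeaf xs idx m j ω) m 1 = 1 ↔ xs j = xs (idx ω) := by
    rw [treeVal_mul]
    simp only [andLeaf, one_mul, Nat.add_sub_cancel_left]
    constructor
    · intro h
      funext t
      have := h t (t.2.trans_le hm)
      rw [dif_pos t.2] at this
      simp only [Fin.eta] at this
      omega
    · intro h i _
      split_ifs with hi
      · rw [h]; omega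
      · rfl
  split_ifs with hc
  · exact h.2 hc
  · have := mt h.1 hc
    omega

/-- The contents of the second family of trees before their evaluation. -/
def andFill (m : ℕ) (ω : Ω) (p : Fin (2 ^ k) × Fin (2 ^ (m + 1))) : Fin 2 :=
  if 2 ^ m ≤ (p.2 : ℕ) then andLeaf xs idx m p.1 ω p.2 else 0

theorem reach_andFill (hm : n ≤ 2 ^ m) (E : Ω → Fin (2 ^ k) → Fin 2) :
    Reach 2 (fun ω => regState (m := m) (xs (idx ω)) (E ω) (fun p => xs (idx ω) p.2) 0 0)
      (fun ω => regState (xs (idx ω)) (E ω) (fun p => xs (idx ω) p.2) 0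
        (andFill xs idx m ω)) := by
  have hlt (t : Fin n) : 2 ^ m + (t : ℕ) < 2 ^ (m + 1) := by
    have := t.2; rw [pow_succ]; omega
  let A : Ω → Fin (2 ^ k) × Fin (2 ^ (m + 1)) → Fin 2 := fun ω p =>
    if h : 2 ^ m ≤ (p.2 : ℕ) ∧ (p.2 : ℕ) - 2 ^ m < n then xs (idx ω) ⟨p.2 - 2 ^ m, h.2⟩ else 0
  have h1 : Reach 1
      (fun ω => regState (m := m) (xs (idx ω)) (E ω) (fun p => xs (idx ω) p.2) 0 0)
      (fun ω => regState (xs (idx ω)) (E ω) (fun p => xs (idx ω) p.2) 0 (A ω)) := by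
    refine Reach.cnots (G := Fin (2 ^ k) × Fin n) tabQ
      (fun p => andQ (p.1, ⟨2 ^ m + (p.2 : ℕ), hlt _⟩)) ?_ ?_ ?_ ?_ ?_
    · intro p p' h; simpa using h
    · intro p p' h
      have h' : p.1 = p'.1 ∧ p.2 = p'.2 := by simpa [Prod.ext_iff, Fin.ext_iff] using h
      exact Prod.ext h'.1 h'.2
    · intro p p' h; simp at h
    · rintro ω ⟨j, t⟩
      change A ω (j, ⟨2 ^ m + (t : ℕ), hlt t⟩) = 0 + xs (idx ω) t
      simp only [A, Nat.add_sub_cancel_left, Nat.le_add_right, true_and, t.2, dif_pos, zero_add,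
        Fin.eta]
    · rintro ω (t | j | p | p | ⟨j, i⟩) hq
      · rfl
      · rfl
      · rfl
      · rfl
      · change A ω (j, i) = 0
        refine dif_neg fun h => hq (j, ⟨i - 2 ^ m, h.2⟩) ?_
        simp only [Sum.inr.injEq, Prod.mk.injEq, true_and]
        exact Fin.ext (by dsimp only at h ⊢; omega)
  refine h1.trans (Reach.nots (G := {p : Fin (2 ^ k) × Fin (2 ^ (m + 1)) //
    2 ^ m ≤ (p.2 : ℕ) ∧ ∀ h : (p.2 : ℕ) - 2 ^ m < n, xs p.1 ⟨p.2 - 2 ^ m, h⟩ = 0})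
    (fun p => andQ p.1) ?_ ?_ ?_)
  · intro p p' h
    exact Subtype.ext (by simpa using h)
  · rintro ω ⟨⟨j, i⟩, hi, hx⟩
    change andFill xs idx m ω (j, i) = A ω (j, i) + 1
    simp only [andFill, andLeaf, A]
    dsimp only at hi hx
    rw [if_pos hi]
    by_cases h : (i : ℕ) - 2 ^ m < n
    · rw [dif_pos h, dif_pos ⟨hi, h⟩, hx h, add_zero]
    · rw [dif_neg h, dif_neg fun h' => h h'.2]; rfl
  · rintro ω (t | j | p | p | ⟨j, i⟩) hq
    · rfl
    · rfl
    · rfl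
    · rfl
    · change andFill xs idx m ω (j, i) = A ω (j, i)
      simp only [andFill, andLeaf, A]
      by_cases hi : 2 ^ m ≤ (i : ℕ)
      · by_cases h : (i : ℕ) - 2 ^ m < n
        · rw [if_pos hi, dif_pos h, dif_pos ⟨hi, h⟩]
          have h1 : xs j ⟨i - 2 ^ m, h⟩ = 1 := by
            by_contra h2
            refine hq ⟨(j, i), hi, fun _ => ?_⟩ rfl
            dsimp only
            omega
          rw [h1]; omega
        · exact absurd rfl (hq ⟨(j, i), hi, fun h' => absurd h' h⟩)
      · rw [if_neg hi, dif_neg fun h' => hi h'.1]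

/-- Clearing the one-hot register by comparing the label with all others. -/
theorem reach_clear [Finite Ω] (hm : n ≤ 2 ^ m) (hidx : Function.Injective idx)
    (hxs : Function.Injective fun ω => xs (idx ω)) :
    Reach (2 * (k + 3) + (10 * m + 1))
      (fun ω => regState (m := m) (xs (idx ω)) (Pi.single (idx ω) 1) 0 0 0)
      (fun ω => regState (xs (idx ω)) 0 0 0 0) := by
  have h1 (E : Ω → Fin (2 ^ k) → Fin 2) := (reach_copy_columns (m := m)
    (fun ω => xs (idx ω)) E).trans (reach_andFill xs idx hm E)
  have h2 : Reach (5 * m + 1 + 5 * m)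
      (fun ω => regState (xs (idx ω)) (Pi.single (idx ω) 1) (fun p => xs (idx ω) p.2) 0
        (andFill xs idx m ω))
      (fun ω => regState (xs (idx ω)) 0 (fun p => xs (idx ω) p.2) 0 (andFill xs idx m ω)) := by
    refine Reach.tree (G := Ω) reach_toffoli (fun ω' i => andQ (idx ω', i))
      (fun ω' => hotQ (idx ω')) ?_ ?_ ?_ (fun ω' => andLeaf xs idx m (idx ω')) ?_ ?_ ?_
    · intro p p' h
      have h' : idx p.1 = idx p'.1 ∧ p.2 = p'.2 := by simpa [Prod.ext_iff] using h
      exact Prod.ext (hidx h'.1) h'.2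
    · intro t t' h
      exact hidx (by simpa using h)
    · intro t i t' h; simp at h
    · intro ω t i; rfl
    · intro ω ω'
      rw [treeVal_andLeaf xs idx hm]
      change 0 = (Pi.single (idx ω) 1 : Fin (2 ^ k) → Fin 2) (idx ω') + _
      rw [Pi.single_apply]
      by_cases h : ω' = ω
      · subst h; simp
      · rw [if_neg (hidx.ne h), if_neg (hxs.ne h), add_zero]
    · rintro ω (t | j | p | p | p) hq
      · rfl
      · change 0 = (Pi.single (idx ω) 1 : Fin (2 ^ k) → Fin 2) j
        rw [Pi.single_eq_of_ne]
        rintro rfl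
        exact hq ω rfl
      · rfl
      · rfl
      · rfl
  exact (((h1 _).trans h2).trans (h1 _).symm).mono (by omega)

end Labels

/-! ### The preparation of sparse states -/

section Preparation
variable {n k m : ℕ}

/-- Distinct labels are only needed where the amplitude is nonzero: the classical computation has to
be correct on the one-hot states that occur in the superposition. -/
theorem exists_circuit_of_labels (hn : 1 ≤ n) (hk : 1 ≤ k) (hm : n ≤ 2 ^ m)
    (hm' : Nat.clog 2 n = m) (α : Fin (2 ^ k) → ℂ) (xs : Fin (2 ^ k) → Fin n → Fin 2)
    (hα : ∑ j, ‖α j‖ ^ 2 = 1) (hxs : ∀ i j, α i ≠ 0 → α j ≠ 0 → xs i = xs j → i = j) :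
    ∃ C : Circuit (Fin n ⊕ Anc n k m), C.depth ≤ 13 * (k + m + 1) ∧
      C.run (ket 0) = tensor (∑ j, α j • ket (xs j)) (zeroKet (Anc n k m)) := by
  obtain ⟨C₁, hC₁, hrun₁⟩ := exists_circuit_oneHot hk α hα
  let idx : {j : Fin (2 ^ k) // α j ≠ 0} → Fin (2 ^ k) := Subtype.val
  obtain ⟨C₂, hC₂, hrun₂⟩ := (reach_label (m := m) xs idx hn).trans
    (reach_clear xs idx hm Subtype.val_injective fun i j h => Subtype.ext (hxs i j i.2 j.2 h))
  have hinj : Function.Injective (hotQ : Fin (2 ^ k) → Fin n ⊕ Anc n k m) :=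
    fun j j' h => by simpa using h
  refine ⟨C₁.map hotQ hinj ++ C₂, ?_, ?_⟩
  · have h1 : Circuit.depth (C₁.map hotQ hinj ++ C₂)
        = Circuit.depth (C₁.map (hotQ (m := m) (n := n)) hinj) + C₂.depth := List.length_append
    have h2 : Circuit.depth (C₁.map (hotQ (m := m) (n := n)) hinj) = C₁.depth :=
      List.length_map _
    rw [hm'] at hC₂
    omega
  · have h1 : (C₁.map hotQ hinj).run (ket 0)
        = ∑ j, α j • ket (regState (m := m) (0 : Fin n → Fin 2) (Pi.single j 1) 0 0 0) := by
      funext x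
      have h0 : (0 : Fin n ⊕ Anc n k m → Fin 2) ∘ hotQ = 0 := rfl
      rw [Circuit.map_run_ket hinj, h0, hrun₁]
      have h2 (j : Fin (2 ^ k)) : regState (m := m) (0 : Fin n → Fin 2) (Pi.single j 1) 0 0 0
          = Function.extend hotQ (Pi.single j 1) 0 := by
        funext q
        by_cases hq : ∃ i, hotQ i = q
        · obtain ⟨i, rfl⟩ := hq
          rw [hinj.extend_apply]; rfl
        · rw [Function.extend_apply' _ _ _ hq]
          rcases q with t | i | p | p | p
          · rfl
          · exact absurd ⟨i, rfl⟩ hq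
          · rfl
          · rfl
          · rfl
      simp only [h2, Finset.sum_apply, Pi.smul_apply, ket_extend hinj, smul_eq_mul, mul_ite,
        mul_zero]
      split_ifs with hc
      · rfl
      · exact Finset.sum_const_zero.symm
    rw [Circuit.run_append, h1, Circuit.run_sum]
    have h2 (j : Fin (2 ^ k)) :
        C₂.run (α j • ket (regState (m := m) (0 : Fin n → Fin 2) (Pi.single j 1) 0 0 0))
        = α j • ket (regState (xs j) 0 0 0 0) := by
      by_cases hj : α j = 0
      · simp only [hj, zero_smul, Circuit.run_zero]
      · rw [Circuit.run_smul]
        exact congrArg (α j • ·) (hrun₂ ⟨j, hj⟩)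
    simp only [h2]
    funext x
    simp only [tensor, Finset.sum_apply, Pi.smul_apply, smul_eq_mul, Finset.sum_mul, mul_assoc]
    refine Finset.sum_congr rfl fun j _ => congrArg (α j * ·) ?_
    simp only [ket, zeroKet, mul_ite, mul_one, mul_zero, ← ite_and]
    refine if_congr ⟨?_, ?_⟩ rfl rfl
    · rintro rfl
      refine ⟨?_, rfl⟩
      rintro (i | p | p | p) <;> rfl
    · rintro ⟨h1, h2⟩
      funext q
      rcases q with t | q
      · exact congrFun h2 t
      · rw [h1 q]
        rcases q with i | p | p | p <;> rfl

/-- Enumeration of the nonzero amplitudes of a sparse state by `2 ^ k` labels; unused labels have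
amplitude zero. -/
theorem exists_labels {d : ℕ} (hd : d ≤ 2 ^ k) {ψ : Ket (Fin n)} (hψ : IsState ψ)
    (hs : IsSparse d ψ) : ∃ (α : Fin (2 ^ k) → ℂ) (xs : Fin (2 ^ k) → Fin n → Fin 2),
      ∑ j, ‖α j‖ ^ 2 = 1 ∧ (∀ i j, α i ≠ 0 → α j ≠ 0 → xs i = xs j → i = j) ∧
      ψ = ∑ j, α j • ket (xs j) := by
  classical
  have hcard : Fintype.card (Function.support ψ) ≤ Fintype.card (Fin (2 ^ k)) := by
    rw [Fintype.card_fin, ← Nat.card_eq_fintype_card]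
    exact hs.trans hd
  obtain ⟨f⟩ := Function.Embedding.nonempty_of_card_le hcard
  let α : Fin (2 ^ k) → ℂ := Function.extend f (fun x => ψ x) 0
  let xs : Fin (2 ^ k) → Fin n → Fin 2 := Function.extend f Subtype.val 0
  have h1 (x : Function.support ψ) : α (f x) = ψ x := f.injective.extend_apply _ _ _
  have h2 (x : Function.support ψ) : xs (f x) = x := f.injective.extend_apply _ _ _
  have h3 (j : Fin (2 ^ k)) (hj : ¬∃ x, f x = j) : α j = 0 := Function.extend_apply' _ _ _ hj
  refine ⟨α, xs, ?_, fun i j hi hj hij => ?_, ?_⟩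
  · rw [← Fintype.sum_of_injective f f.injective (fun x => ‖ψ x‖ ^ 2) _
      (fun j hj => by rw [h3 j hj]; simp) (fun x => by rw [h1])]
    rw [← hψ]
    exact Fintype.sum_of_injective Subtype.val Subtype.val_injective _ _
      (fun x hx => by
        have : ψ x = 0 := by
          by_contra h
          exact hx ⟨⟨x, h⟩, rfl⟩
        rw [this]; simp) (fun _ => rfl)
  · obtain ⟨x, rfl⟩ : ∃ x, f x = i := by_contra fun h => hi (h3 i h)
    obtain ⟨y, rfl⟩ : ∃ y, f y = j := by_contra fun h => hj (h3 j h)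
    rw [h2, h2] at hij
    rw [Subtype.ext hij]
  · rw [← Fintype.sum_of_injective f f.injective (fun x : Function.support ψ => ψ x • ket x) _
      (fun j hj => by rw [h3 j hj, zero_smul]) (fun x => by rw [h1, h2])]
    funext y
    simp only [Finset.sum_apply, Pi.smul_apply, ket, smul_eq_mul, mul_ite, mul_one, mul_zero]
    by_cases hy : ψ y = 0
    · rw [hy, eq_comm]
      refine Finset.sum_eq_zero fun x _ => if_neg ?_
      rintro rfl
      exact x.2 hy
    · rw [Finset.sum_eq_single ⟨y, hy⟩]
      · simp
      · intro x _ hx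
        exact if_neg fun h => hx (Subtype.ext h.symm)
      · simp

theorem two_pow_clog_lt {N : ℕ} (hN : 1 ≤ N) : 2 ^ Nat.clog 2 N < 2 * N := by
  rcases Nat.eq_or_lt_of_le hN with rfl | h
  · simp
  · have h1 := Nat.pow_pred_clog_lt_self one_lt_two h
    have h2 : 0 < Nat.clog 2 N := Nat.clog_pos one_lt_two h
    obtain ⟨c, hc⟩ : ∃ c, Nat.clog 2 N = c + 1 := ⟨Nat.clog 2 N - 1, by omega⟩
    rw [hc] at h1 ⊢
    rw [pow_succ]
    simp only [Nat.pred_succ] at h1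
    omega

theorem clog_mul_log_two_le {N : ℕ} (hN : 1 ≤ N) :
    (Nat.clog 2 N : ℝ) * Real.log 2 ≤ Real.log 2 + Real.log N := by
  have h : ((2 : ℝ) ^ Nat.clog 2 N) ≤ 2 * N := by exact_mod_cast (two_pow_clog_lt hN).le
  have hN' : (0 : ℝ) < N := by exact_mod_cast hN
  have h1 := Real.log_le_log (by positivity) h
  rwa [Real.log_pow, Real.log_mul two_ne_zero hN'.ne'] at h1

theorem exists_depth_upper_bound : ∃ K : ℝ, 0 < K ∧ ∀ n d : ℕ, 1 ≤ n → 2 ≤ d →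
      ∀ ψ : Ket (Fin n), IsState ψ → IsSparse d ψ →
        ∃ (a : ℕ) (C : Circuit (Fin n ⊕ Fin a)),
          C.PreparesClean ψ ∧
          (C.depth : ℝ) ≤ K * Real.log ((n : ℝ) * (d : ℝ)) ∧
          (a : ℝ) ≤ K * ((n : ℝ) * (d : ℝ) * Real.log (d : ℝ)) := by
  have hl2 : 0 < Real.log 2 := Real.log_pos one_lt_two
  refine ⟨52 / Real.log 2, by positivity, fun n d hn hd ψ hψ hs => ?_⟩
  set k := Nat.clog 2 d with hkdef
  set m := Nat.clog 2 n with hmdef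
  have hk : 1 ≤ k := Nat.clog_pos one_lt_two hd
  obtain ⟨α, xs, hα, hxs, hsum⟩ := exists_labels (Nat.le_pow_clog one_lt_two d) hψ hs
  obtain ⟨C, hC, hrun⟩ := exists_circuit_of_labels hn hk (Nat.le_pow_clog one_lt_two n) rfl α xs
    hα hxs
  rw [← hsum] at hrun
  -- the ancillas are numbered to match the type of the circuit
  let e := Fintype.equivFin (Anc n k m)
  let e' : Fin n ⊕ Anc n k m → Fin n ⊕ Fin (Fintype.card (Anc n k m)) := Sum.map id e
  have he' : Function.Injective e' := Sum.map_injective.2 ⟨Function.injective_id, e.injective⟩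
  have hsurj (q) : ∃ i, e' i = q := by
    rcases q with t | i
    · exact ⟨Sum.inl t, rfl⟩
    · exact ⟨Sum.inr (e.symm i), congrArg Sum.inr (e.apply_symm_apply i)⟩
  have hn' : (0 : ℝ) < n := by exact_mod_cast hn
  have hd' : (0 : ℝ) < d := by exact_mod_cast (by omega : 0 < d)
  have hlogn : 0 ≤ Real.log n := Real.log_nonneg (by exact_mod_cast hn)
  have hlogd : Real.log 2 ≤ Real.log d := Real.log_le_log two_pos (by exact_mod_cast hd)
  refine ⟨_, C.map e' he', ?_, ?_, ?_⟩
  · have h1 : (C.map e' he').output = (C.map e' he').run (ket 0) := by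
      rw [← zeroKet_eq_ket]; rfl
    unfold Circuit.PreparesClean
    rw [h1]
    funext x
    have h0 : (0 : Fin n ⊕ Fin (Fintype.card (Anc n k m)) → Fin 2) ∘ e' = 0 := rfl
    rw [Circuit.map_run_ket he', if_pos fun q hq => absurd (hsurj q) hq, h0, hrun]
    refine congrArg (ψ (fun i => x (Sum.inl i)) * ·) ?_
    by_cases h : ∀ i, x (Sum.inr i) = 0
    · exact (if_pos fun i => h (e i)).trans (if_pos h).symm
    · refine (if_neg fun h' => h fun i => ?_).trans (if_neg h).symm
      have := h' (e.symm i)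
      simpa [e'] using this
  · have h1 : Circuit.depth (C.map e' he') = C.depth := List.length_map _
    rw [h1, Real.log_mul hn'.ne' hd'.ne', div_mul_eq_mul_div, le_div_iff₀ hl2]
    have h2 : (C.depth : ℝ) ≤ 13 * (k + m + 1) := by exact_mod_cast hC
    have h3 := clog_mul_log_two_le hn
    have h4 := clog_mul_log_two_le (by omega : 1 ≤ d)
    rw [← hkdef] at h4
    rw [← hmdef] at h3
    nlinarith
  · have h1 : Fintype.card (Anc n k m) ≤ 16 * (n * d) := by
      have h2 := two_pow_clog_lt hn
      have h3 := two_pow_clog_lt (by omega : 1 ≤ d)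
      rw [← hkdef] at h3
      rw [← hmdef] at h2
      simp only [Fintype.card_sum, Fintype.card_prod, Fintype.card_fin, pow_succ]
      have h4 : 2 ^ k * 2 ^ m ≤ 2 * d * (2 * n) := Nat.mul_le_mul h3.le h2.le
      have h5 : 2 ^ k * n ≤ 2 * d * n := Nat.mul_le_mul_right _ h3.le
      have h6 : 2 ^ k ≤ 2 ^ k * n := Nat.le_mul_of_pos_right _ hn
      nlinarith
    have h2 : (Fintype.card (Anc n k m) : ℝ) ≤ 16 * (n * d) := by exact_mod_cast h1
    rw [div_mul_eq_mul_div, le_div_iff₀ hl2]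
    have h3 : 0 < (n : ℝ) * d := by positivity
    nlinarith [mul_le_mul_of_nonneg_left hlogd h3.le]

end Preparation

end SparsePrep

theorem theorem2 :
    (∃ K : ℝ, 0 < K ∧ ∀ n d : ℕ, 1 ≤ n → 2 ≤ d →
      ∀ ψ : SparsePrep.Ket (Fin n), SparsePrep.IsState ψ → SparsePrep.IsSparse d ψ →
        ∃ (a : ℕ) (C : SparsePrep.Circuit (Fin n ⊕ Fin a)),
          C.PreparesClean ψ ∧
          (C.depth : ℝ) ≤ K * Real.log ((n : ℝ) * (d : ℝ)) ∧
          (a : ℝ) ≤ K * ((n : ℝ) * (d : ℝ) * Real.log (d : ℝ))) ∧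
    (∃ c : ℝ, 0 < c ∧ ∀ n d : ℕ, 2 ≤ d → d ≤ 2 ^ n →
      ∃ ψ : SparsePrep.Ket (Fin n), SparsePrep.IsState ψ ∧ SparsePrep.IsSparse d ψ ∧
        ∀ (a : ℕ) (C : SparsePrep.Circuit (Fin n ⊕ Fin a)),
          C.Prepares ψ → c * Real.log ((n : ℝ) * (d : ℝ)) ≤ (C.depth : ℝ)) :=
  ⟨SparsePrep.exists_depth_upper_bound, SparsePrep.exists_depth_lower_bound⟩
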